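/- Let $\mathsf{RCA}_0$ be the system of second-order arithmetic consisting of the basic axioms of arithmetic, $\Sigma^0_1$ induction and $\Delta^0_1$ comprehension (with parameters). A Boolean relation $R \subseteq \{0,1\}^n$ is affine if it is the set of solutions of a finite conjunction of equations $x_{i_1} \oplus \dots \oplus x_{i_k} = b$ with $b \in \{0,1\}$, in the variables $x_1, \dots, x_n$. An affine formula over a set of variables $V$ is here a formula $R(y_1, \dots, y_n)$ with $R \subseteq \{0,1\}^n$ affine and $y_1, \dots, y_n \in V$, not necessarily distinct. A set $C$ of such formulas is finitely satisfiable if every conjunction of finitely many members of $C$ is satisfiable. A set $H \subseteq V$ is homogeneous for $C$ if there is a truth value $c \in \{0,1\}$ such that every conjunction of finitely many members of $C$ is satisfied by an assignment $\nu$ with $\nu(a) = c$ for all $a \in H$. Let $\mathsf{RSAT}_{\mathrm{affine}}$ be the statement: for every finitely satisfiable set $C$ of affine formulas over an infinite set $V$ of variables, there is an infinite set $H \subseteq V$ which is homogeneous for $C$. Let $\mathsf{DNR}$ be the statement: for every set $X$ there is a total function $f$ which is diagonally non-computable relative to $X$, that is, for every $e$, it is not the case that $\Phi_e^X(e)$ is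 defined and equal to $f(e)$. **Theorem.** $\mathsf{RCA}_0 \vdash \mathsf{RSAT}_{\mathrm{affine}} \to \mathsf{DNR}$. Equivalently, every model of $\mathsf{RCA}_0$ (with a possibly nonstandard first-order part) which satisfies $\mathsf{RSAT}_{\mathrm{affine}}$ satisfies $\mathsf{DNR}$. -/

import Mathlib

universe u

/-- A structure for the language of second-order arithmetic (Henkin semantics): a first-order part
with `0, 1, +, ·, <` and a collection of subsets of it over which the set quantifiers range.
The first-order part may be nonstandard. -/
structure L2Structure : Type (u + 1) where
  /-- the numbers of the structure -/
  Num : Type u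
  zero : Num
  one : Num
  add : Num → Num → Num
  mul : Num → Num → Num
  lt : Num → Num → Prop
  /-- the sets of the structure -/
  sets : Set (Set Num)

namespace L2Structure

instance (M : L2Structure.{u}) : Zero M.Num := ⟨M.zero⟩
instance (M : L2Structure.{u}) : One M.Num := ⟨M.one⟩
instance (M : L2Structure.{u}) : Add M.Num := ⟨M.add⟩
instance (M : L2Structure.{u}) : Mul M.Num := ⟨M.mul⟩
instance (M : L2Structure.{u}) : LT M.Num := ⟨M.lt⟩

end L2Structure

/-! ### Syntax: bounded-quantifier formulas, and the system of axioms -/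

/-- Number terms of the language of second-order arithmetic; number variables are de Bruijn
indices. -/
inductive L2Term : Type
  | var : ℕ → L2Term
  | zero : L2Term
  | one : L2Term
  | add : L2Term → L2Term → L2Term
  | mul : L2Term → L2Term → L2Term

/-- Bounded-quantifier formulas of the language of second-order arithmetic, with free number
variables and free set variables. In `ball t φ` (for all `x < t`, `φ`) and `bex t φ` (there is
`x < t` with `φ`) the bound variable is index `0` of `φ`; it does not occur in `t`. -/
inductive L2Bounded : Type
  | eq : L2Term → L2Term → L2Bounded
  | lt : L2Term → L2Term → L2Bounded
  | mem : L2Term → ℕ → L2Bounded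
  | not : L2Bounded → L2Bounded
  | and : L2Bounded → L2Bounded → L2Bounded
  | or : L2Bounded → L2Bounded → L2Bounded
  | ball : L2Term → L2Bounded → L2Bounded
  | bex : L2Term → L2Bounded → L2Bounded

/-- The valuation `v` with `a` put in front. -/
def consVal {α : Type u} (a : α) (v : ℕ → α) : ℕ → α
  | 0 => a
  | i + 1 => v i

/-- The value of a term. -/
def L2Term.val (M : L2Structure.{u}) (v : ℕ → M.Num) : L2Term → M.Num
  | .var i => v i
  | .zero => 0
  | .one => 1
  | .add s t => s.val M v + t.val M v
  | .mul s t => s.val M v * t.val M v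

/-- Truth of a bounded-quantifier formula under a valuation `v` of the number variables and `W` of
the set variables. -/
def L2Bounded.Holds (M : L2Structure.{u}) (W : ℕ → Set M.Num) :
    L2Bounded → (ℕ → M.Num) → Prop
  | .eq s t, v => s.val M v = t.val M v
  | .lt s t, v => s.val M v < t.val M v
  | .mem s i, v => s.val M v ∈ W i
  | .not φ, v => ¬ φ.Holds M W v
  | .and φ ψ, v => φ.Holds M W v ∧ ψ.Holds M W v
  | .or φ ψ, v => φ.Holds M W v ∨ ψ.Holds M W v
  | .ball t φ, v => ∀ a : M.Num, a < t.val M v → φ.Holds M W (consVal a v)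
  | .bex t φ, v => ∃ a : M.Num, a < t.val M v ∧ φ.Holds M W (consVal a v)

namespace L2Structure

variable (M : L2Structure.{u})

/-- `{n | P n}` is defined in `M` by a `Σ⁰₁` formula `∃ a, φ(a, n, …)`, where `φ` is a
bounded-quantifier formula with number and set parameters from `M`. -/
def IsSigma01 (P : M.Num → Prop) : Prop :=
  ∃ (φ : L2Bounded) (v : ℕ → M.Num) (W : ℕ → Set M.Num), (∀ i, W i ∈ M.sets) ∧
    ∀ n, P n ↔ ∃ a, φ.Holds M W (consVal a (consVal n v))

/-- `{n | P n}` is defined in `M` by a `Π⁰₁` formula `∀ a, φ(a, n, …)`, where `φ` is a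
bounded-quantifier formula with number and set parameters from `M`. -/
def IsPi01 (P : M.Num → Prop) : Prop :=
  ∃ (φ : L2Bounded) (v : ℕ → M.Num) (W : ℕ → Set M.Num), (∀ i, W i ∈ M.sets) ∧
    ∀ n, P n ↔ ∀ a, φ.Holds M W (consVal a (consVal n v))

/-- `M` is a model of `RCA₀`: the basic axioms of arithmetic, `Σ⁰₁` induction and `Δ⁰₁`
comprehension, both with parameters. -/
structure IsModelRCA0 : Prop where
  succ_ne_zero : ∀ n : M.Num, n + 1 ≠ 0
  succ_inj : ∀ m n : M.Num, m + 1 = n + 1 → m = n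
  add_zero : ∀ m : M.Num, m + 0 = m
  add_succ : ∀ m n : M.Num, m + (n + 1) = (m + n) + 1
  mul_zero : ∀ m : M.Num, m * 0 = 0
  mul_succ : ∀ m n : M.Num, m * (n + 1) = m * n + m
  not_lt_zero : ∀ m : M.Num, ¬ m < 0
  lt_succ_iff : ∀ m n : M.Num, m < n + 1 ↔ (m < n ∨ m = n)
  sigma01_induction : ∀ P : M.Num → Prop, M.IsSigma01 P →
    P 0 → (∀ n, P n → P (n + 1)) → ∀ n, P n
  delta01_comprehension : ∀ P : M.Num → Prop, M.IsSigma01 P → M.IsPi01 P →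
    ∃ X ∈ M.sets, ∀ n, n ∈ X ↔ P n

/-! ### Finite sets and finite sequences inside a structure

Everything below is first-order over `(M.Num, M.sets)`: all quantifiers range over numbers or over
sets of the structure, so these are sentences and formulas of second-order arithmetic. -/

/-- A set of numbers is finite (in the sense of the structure) if it is bounded. -/
def IsFinite (X : Set M.Num) : Prop := ∃ k, ∀ i ∈ X, i < k

/-- A set of numbers is infinite (in the sense of the structure) if it is unbounded. -/
def IsInfinite (X : Set M.Num) : Prop := ¬ M.IsFinite X

variable {M}

/-- The pairing function `(a, b) ↦ (a + b)² + a`. -/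
def pair (a b : M.Num) : M.Num := (a + b) * (a + b) + a

/-- `i` belongs to the finite set with code `c = (k, (m, n))`, that is,
`i < k` and `m(i+1)+1` divides `n`. -/
def InCode (i c : M.Num) : Prop :=
  ∃ k m n, c = pair k (pair m n) ∧ i < k ∧ ∃ q, n = (m * (i + 1) + 1) * q

/-- `c` is the code of a finite set: the least among the numbers which decode to that set.
(Numbers which are not triples decode to the empty set, whose code is `0`.) -/
def IsFinCode (c : M.Num) : Prop :=
  ∀ c', c' < c → ¬ ∀ i, InCode i c' ↔ InCode i c

/-- `s` is the code of a finite sequence of length `n`, that is, of the finite set of pairs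
`(i, s i)`, `i < n`. -/
def IsSeq (n s : M.Num) : Prop :=
  IsFinCode s ∧ (∀ p, InCode p s → ∃ i v, i < n ∧ p = pair i v) ∧
    ∀ i, i < n → ∃! v, InCode (pair i v) s

/-- `v` is the entry of index `i` in the finite sequence `s`. -/
def SeqVal (s i v : M.Num) : Prop := InCode (pair i v) s

/-! ### Boolean relations, affine relations, formulas -/

/-- `σ` is (the code of) a Boolean vector `a` of length `n`, represented by the finite set
`{i < n | a i = 1}`. -/
def IsVector (n σ : M.Num) : Prop := IsFinCode σ ∧ ∀ i, InCode i σ → i < n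

/-- `R` is (the code of) a Boolean relation of arity `n`, a finite set of Boolean vectors of
length `n`. -/
def IsRelation (n R : M.Num) : Prop := IsFinCode R ∧ ∀ σ, InCode σ R → IsVector n σ

/-- The Boolean vector `σ` of length `n` satisfies the equation `⨁_{i ∈ J} x_i = b`, where `J` is
a finite set of indices below `n`. The finite set `P` lists those `j ≤ n` for which
`⨁_{i ∈ J, i < j} σ i = 1`. -/
def XorEq (n σ J b : M.Num) : Prop :=
  ∃ P, ¬ InCode 0 P ∧
    (∀ i, i < n → (InCode (i + 1) P ↔ ¬ (InCode i P ↔ (InCode i σ ∧ InCode i J)))) ∧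
    (InCode n P ↔ b = 1)

/-- `φ` is (the code of) an affine formula in the variables `x_i`, `i < n`: a finite conjunction
of equations `⨁_{i ∈ J} x_i = b` with `b ∈ {0, 1}`, each coded as the pair `(J, b)`. -/
def IsAffineFormula (n φ : M.Num) : Prop :=
  IsFinCode φ ∧ ∀ ε, InCode ε φ → ∃ J b, ε = pair J b ∧ IsVector n J ∧ (b = 0 ∨ b = 1)

/-- `R` is an affine relation of arity `n`: the set of Boolean vectors of length `n` which satisfy
some affine formula. -/
def IsAffine (n R : M.Num) : Prop :=
  IsRelation n R ∧ ∃ φ, IsAffineFormula n φ ∧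
    ∀ σ, IsVector n σ → (InCode σ R ↔ ∀ J b, InCode (pair J b) φ → XorEq n σ J b)

/-- `θ` is (the code of) an `S`-formula `R(y_0, …, y_{n-1})` over the set of variables `V`, where
`R ∈ S` has arity `n` and `y` is a sequence of elements of `V`, possibly with repetitions.
`S n R` says that `R` is a relation of arity `n` which belongs to the class `S`. -/
def IsFormula (S : M.Num → M.Num → Prop) (V : Set M.Num) (θ : M.Num) : Prop :=
  ∃ n R y, θ = pair n (pair R y) ∧ S n R ∧ IsSeq n y ∧ ∀ i v, i < n → SeqVal y i v → v ∈ V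

/-- The assignment which makes exactly the variables in `ν` true satisfies the formula `θ`, that
is, `R(y_0, …, y_{n-1})`: the vector of the truth values of `y_0, …, y_{n-1}` belongs to `R`. -/
def Satisfies (ν : Set M.Num) (θ : M.Num) : Prop :=
  ∃ n R y, θ = pair n (pair R y) ∧
    ∃ σ, InCode σ R ∧ ∀ i v, i < n → SeqVal y i v → (InCode i σ ↔ v ∈ ν)

variable (M)

/-- Every conjunction of a finite set of formulas in `C` is satisfiable. -/
def FinitelySatisfiable (C : Set M.Num) : Prop :=
  ∀ F ∈ M.sets, M.IsFinite F → F ⊆ C → ∃ ν ∈ M.sets, ∀ θ ∈ F, Satisfies ν θ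

/-- `H` is homogeneous for `C`: for some truth value `c`, every conjunction of a finite set of
formulas in `C` is satisfiable by an assignment which has the value `c` on `H`. -/
def Homogeneous (C H : Set M.Num) : Prop :=
  ∃ c : Bool, ∀ F ∈ M.sets, M.IsFinite F → F ⊆ C →
    ∃ ν ∈ M.sets, (∀ θ ∈ F, Satisfies ν θ) ∧ ∀ a ∈ H, (a ∈ ν ↔ c = true)

/-- The Ramsey-type satisfiability principle for the class `S` of Boolean relations: for every
finitely satisfiable set `C` of `S`-formulas over an infinite set of variables `V` there is an
infinite set `H ⊆ V` which is homogeneous for `C`. -/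
def RSAT (S : M.Num → M.Num → Prop) : Prop :=
  ∀ V ∈ M.sets, M.IsInfinite V → ∀ C ∈ M.sets, (∀ θ ∈ C, IsFormula S V θ) →
    M.FinitelySatisfiable C → ∃ H ∈ M.sets, M.IsInfinite H ∧ H ⊆ V ∧ M.Homogeneous C H

/-- The Ramsey-type satisfiability principle for affine relations. -/
def RSATAffine : Prop := M.RSAT IsAffine

/-! ### Oracle computations and diagonally non-computable functions -/

variable {M}

/-- One step of the register machine with program `e` and oracle `X`. A program is a finite
sequence of instructions; a configuration `(p, s)` consists of a program counter `p` and the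
finite sequence `s` of the contents of the registers. The instructions are:
* `(0, r)`: increment register `r` and go to the next instruction;
* `(1, (r, q))`: if register `r` is `0` go to instruction `q`, otherwise decrement register `r`
  and go to the next instruction;
* `(2, r)`: replace the content `v` of register `r` by `1` if `v ∈ X` and by `0` otherwise, and go
  to the next instruction. -/
def Step (X : Set M.Num) (e p s p' s' : M.Num) : Prop :=
  ∃ r v v', SeqVal s r v ∧ SeqVal s' r v' ∧
    (∀ i, i ≠ r → ∀ w, SeqVal s i w ↔ SeqVal s' i w) ∧
    ((SeqVal e p (pair 0 r) ∧ v' = v + 1 ∧ p' = p + 1) ∨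
      (∃ q, SeqVal e p (pair 1 (pair r q)) ∧
        ((v = 0 ∧ v' = 0 ∧ p' = q) ∨ (v = v' + 1 ∧ p' = p + 1))) ∨
      (SeqVal e p (pair (1 + 1) r) ∧ ((v ∈ X ∧ v' = 1) ∨ (v ∉ X ∧ v' = 0)) ∧ p' = p + 1))

/-- `Φ_e^X(x) = y`: the number `e` codes a program, and the machine with program `e` and oracle
`X`, started at instruction `0` with `x` in register `0` and `0` in the other registers, halts
(that is, its program counter leaves the program) with `y` in register `0`. Here `ℓ` is the length
of the program, `L` is a sufficiently large number of registers, `T` is the halting time, and `h`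
is the finite sequence of the configurations at the times `0, …, T`. -/
def Computes (X : Set M.Num) (e x y : M.Num) : Prop :=
  ∃ ℓ L T h, IsSeq ℓ e ∧ IsSeq (T + 1) h ∧
    (∀ t c, t < T + 1 → SeqVal h t c → ∃ p s, c = pair p s ∧ IsSeq L s) ∧
    (∃ s, SeqVal h 0 (pair 0 s) ∧ SeqVal s 0 x ∧ ∀ i, i < L → i ≠ 0 → SeqVal s i 0) ∧
    (∀ t, t < T → ∃ p s p' s',
      SeqVal h t (pair p s) ∧ SeqVal h (t + 1) (pair p' s') ∧ Step X e p s p' s') ∧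
    ∃ p s, SeqVal h T (pair p s) ∧ ¬ p < ℓ ∧ SeqVal s 0 y

variable (M)

/-- `f` is (the graph, as a set of pairs, of) a total function. -/
def IsFunction (f : Set M.Num) : Prop :=
  (∀ p ∈ f, ∃ x y, p = pair x y) ∧ ∀ x, ∃! y, pair x y ∈ f

/-- For every set `X` there is a total function `f` which is diagonally non-computable relative
to `X`: for all `e`, it is not the case that `Φ_e^X(e)` is defined and equal to `f e`. -/
def DNR : Prop :=
  ∀ X ∈ M.sets, ∃ f ∈ M.sets, M.IsFunction f ∧
    ∀ e y, pair e y ∈ f → ¬ Computes X e e y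

end L2Structure

/-! The engine is a parity argument. An equation that asks an even number of variables to have sum 1
fails under every assignment that is constant on those variables. Fix `X`. Whenever `Φ_e^X(e)`
converges to the code `y` of an injective sequence of `2^(e+1)` variables, the equation `y_0 ⊕ ⋯ =
1` goes into `C`. An infinite homogeneous `H` cannot contain all the variables of such an equation
(`IsOddClause.not_satisfies`). Hence the function that sends `e` to the least code of `2^(e+1)`
distinct elements of `H` is diagonally non-computable relative to `X`.

Finite satisfiability comes from the choice of lengths. Computations are deterministic
(`Computes.unique`), so each `e` contributes at most one sequence. The sequences for `i < e` have at
most `2 + 4 + ⋯ + 2^e = 2^(e+1) - 2` entries together, so the sequence for `e` has a pivot variable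
outside all of them (`exists_pivot`). The system is therefore triangular: going up through `e` and
flipping the pivot whenever the equation fails never spoils an earlier equation
(`exists_assignment`).

Convergence is only `Σ⁰₁`, while `C` has to be a set of the model. So each clause carries one
further variable, ignored by its relation, whose number codes a witness `a` of convergence together
with `e` and `y`. The clause then bounds the witness, and membership in `C` is `Δ⁰₁`.

The model may be nonstandard, so every count and recursion is an instance of `Σ⁰₁` induction on
coded objects. This rests on closure of `Σ⁰₁` under bounded quantification (`Sig.ball_tm`) and on
Gödel's coding of finite sets by divisibility (`IsCodeBound.exists_code`). Parities are read from
tables, powers of two from finite histories, and the pigeonhole principle deletes one entry at a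
time. -/

/-! ### Renaming of variables in bounded-quantifier formulas -/

/-- The valuation `v` without its first entry. -/
abbrev tailVal {α : Type u} (v : ℕ → α) : ℕ → α := fun i => v (i + 1)

/-- Renaming of the number variables of a term. -/
def L2Term.ren (f : ℕ → ℕ) : L2Term → L2Term
  | .var i => .var (f i)
  | .zero => .zero
  | .one => .one
  | .add s t => .add (s.ren f) (t.ren f)
  | .mul s t => .mul (s.ren f) (t.ren f)

/-- A renaming of variables, extended to one more bound variable. -/
def liftRen (f : ℕ → ℕ) : ℕ → ℕ
  | 0 => 0
  | i + 1 => f i + 1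

/-- Renaming of the number variables (by `f`) and of the set variables (by `g`) of a formula. -/
def L2Bounded.ren (g : ℕ → ℕ) : (ℕ → ℕ) → L2Bounded → L2Bounded
  | f, .eq s t => .eq (s.ren f) (t.ren f)
  | f, .lt s t => .lt (s.ren f) (t.ren f)
  | f, .mem s i => .mem (s.ren f) (g i)
  | f, .not φ => .not (φ.ren g f)
  | f, .and φ ψ => .and (φ.ren g f) (ψ.ren g f)
  | f, .or φ ψ => .or (φ.ren g f) (ψ.ren g f)
  | f, .ball t φ => .ball (t.ren f) (φ.ren g (liftRen f))
  | f, .bex t φ => .bex (t.ren f) (φ.ren g (liftRen f))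

theorem consVal_liftRen {α : Type u} (a : α) (v : ℕ → α) (f : ℕ → ℕ) :
    (fun i => consVal a v (liftRen f i)) = consVal a (fun i => v (f i)) := by
  funext i
  cases i <;> rfl

theorem L2Term.val_ren (M : L2Structure.{u}) (f : ℕ → ℕ) (v : ℕ → M.Num) (t : L2Term) :
    (t.ren f).val M v = t.val M (fun i => v (f i)) := by
  induction t with
  | var i => rfl
  | zero => rfl
  | one => rfl
  | add s t hs ht => simp only [L2Term.ren, L2Term.val, hs, ht]
  | mul s t hs ht => simp only [L2Term.ren, L2Term.val, hs, ht]

theorem L2Bounded.holds_ren (M : L2Structure.{u}) (W : ℕ → Set M.Num) (g f : ℕ → ℕ)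
    (v : ℕ → M.Num) (φ : L2Bounded) :
    (φ.ren g f).Holds M W v ↔ φ.Holds M (fun i => W (g i)) (fun i => v (f i)) := by
  induction φ generalizing f v with
  | eq s t => simp only [L2Bounded.ren, L2Bounded.Holds, L2Term.val_ren]
  | lt s t => simp only [L2Bounded.ren, L2Bounded.Holds, L2Term.val_ren]
  | mem s i => simp only [L2Bounded.ren, L2Bounded.Holds, L2Term.val_ren]
  | not φ h => simp only [L2Bounded.ren, L2Bounded.Holds, h]
  | and φ ψ h h' => simp only [L2Bounded.ren, L2Bounded.Holds, h, h']
  | or φ ψ h h' => simp only [L2Bounded.ren, L2Bounded.Holds, h, h']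
  | ball t φ h =>
    simp only [L2Bounded.ren, L2Bounded.Holds, L2Term.val_ren, h, consVal_liftRen]
  | bex t φ h =>
    simp only [L2Bounded.ren, L2Bounded.Holds, L2Term.val_ren, h, consVal_liftRen]

/-- The sequence `v 0, p 0, v 1, p 1, …`. -/
def mixVal {α : Type u} (v p : ℕ → α) (i : ℕ) : α := if i % 2 = 0 then v (i / 2) else p (i / 2)

theorem mixVal_even {α : Type u} (v p : ℕ → α) (i : ℕ) : mixVal v p (2 * i) = v i := by
  simp [mixVal]

theorem mixVal_odd {α : Type u} (v p : ℕ → α) (i : ℕ) : mixVal v p (2 * i + 1) = p i := by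
  have h : (2 * i + 1) / 2 = i := by omega
  simp [mixVal, h]

/-- Variables sit at even indices and parameters at odd ones. A renaming that respects this parity
acts on the two separately, which is how parameters are merged or moved below. -/
theorem mixVal_ren {α : Type u} (v p : ℕ → α) (f g : ℕ → ℕ) :
    (fun i => mixVal v p (mixVal (fun j => 2 * f j) (fun j => 2 * g j + 1) i)) =
      mixVal (fun i => v (f i)) (fun i => p (g i)) := by
  funext i
  rcases Nat.even_or_odd' i with ⟨k, rfl | rfl⟩
  · simp only [mixVal_even]
  · simp only [mixVal_odd]

/-- The renaming which moves a quantified variable to the front. -/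
def bindRen : ℕ → ℕ :=
  mixVal (fun j => match j with
    | 0 => 0
    | j + 1 => 2 * j + 1) (fun j => 2 * j + 2)

theorem mixVal_consVal {α : Type u} (a : α) (v p : ℕ → α) :
    (fun i => consVal a (mixVal v p) (bindRen i)) = mixVal (consVal a v) p := by
  funext i
  rcases Nat.even_or_odd' i with ⟨k, rfl | rfl⟩
  · simp only [mixVal_even, bindRen]
    cases k with
    | zero => rfl
    | succ k => exact mixVal_even v p k
  · simp only [mixVal_odd, bindRen]
    exact mixVal_odd v p k

namespace L2Structure

variable {M : L2Structure.{u}}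

/-! ### Semantic closure properties of bounded-quantifier definability -/

/-- `t` is given by a term with number parameters. -/
def IsTm (t : (ℕ → M.Num) → M.Num) : Prop :=
  ∃ (p : ℕ → M.Num) (τ : L2Term), ∀ v, t v = τ.val M (mixVal v p)

/-- `P` is given by a bounded-quantifier formula with number and set parameters. -/
def D0 (P : (ℕ → M.Num) → Prop) : Prop :=
  ∃ (W : ℕ → Set M.Num) (p : ℕ → M.Num) (φ : L2Bounded), (∀ i, W i ∈ M.sets) ∧
    ∀ v, P v ↔ φ.Holds M W (mixVal v p)

/-- The two parameter sequences are interleaved, so the parameters of `s` move to the indices `2(2j)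
+ 1` and those of `t` to `2(2j + 1) + 1`. -/
theorem IsTm.common {s t : (ℕ → M.Num) → M.Num} (hs : IsTm s) (ht : IsTm t) :
    ∃ (p : ℕ → M.Num) (σ τ : L2Term), (∀ v, s v = σ.val M (mixVal v p)) ∧
      ∀ v, t v = τ.val M (mixVal v p) := by
  obtain ⟨p, σ, hσ⟩ := hs
  obtain ⟨q, τ, hτ⟩ := ht
  refine ⟨mixVal p q, σ.ren (mixVal (fun j => 2 * j) (fun j => 2 * (2 * j) + 1)),
    τ.ren (mixVal (fun j => 2 * j) (fun j => 2 * (2 * j + 1) + 1)), fun v => ?_, fun v => ?_⟩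
  · rw [hσ, L2Term.val_ren, mixVal_ren v _ (fun j => j) (fun j => 2 * j)]
    simp only [mixVal_even]
  · rw [hτ, L2Term.val_ren, mixVal_ren v _ (fun j => j) (fun j => 2 * j + 1)]
    simp only [mixVal_odd]

theorem D0.common {P Q : (ℕ → M.Num) → Prop} (hP : D0 P) (hQ : D0 Q) :
    ∃ (W : ℕ → Set M.Num) (p : ℕ → M.Num) (φ ψ : L2Bounded), (∀ i, W i ∈ M.sets) ∧
      (∀ v, P v ↔ φ.Holds M W (mixVal v p)) ∧ ∀ v, Q v ↔ ψ.Holds M W (mixVal v p) := by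
  obtain ⟨W, p, φ, hW, hφ⟩ := hP
  obtain ⟨Z, q, ψ, hZ, hψ⟩ := hQ
  refine ⟨mixVal W Z, mixVal p q,
    φ.ren (fun j => 2 * j) (mixVal (fun j => 2 * j) (fun j => 2 * (2 * j) + 1)),
    ψ.ren (fun j => 2 * j + 1) (mixVal (fun j => 2 * j) (fun j => 2 * (2 * j + 1) + 1)),
    fun i => ?_, fun v => ?_, fun v => ?_⟩
  · unfold mixVal
    split_ifs
    exacts [hW _, hZ _]
  · rw [hφ, L2Bounded.holds_ren, mixVal_ren v _ (fun j => j) (fun j => 2 * j)]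
    simp only [mixVal_even]
  · rw [hψ, L2Bounded.holds_ren, mixVal_ren v _ (fun j => j) (fun j => 2 * j + 1)]
    simp only [mixVal_odd]

theorem D0.common_tm {t : (ℕ → M.Num) → M.Num} {P : (ℕ → M.Num) → Prop} (ht : IsTm t)
    (hP : D0 P) :
    ∃ (W : ℕ → Set M.Num) (p : ℕ → M.Num) (τ : L2Term) (φ : L2Bounded), (∀ i, W i ∈ M.sets) ∧
      (∀ v, t v = τ.val M (mixVal v p)) ∧ ∀ v, P v ↔ φ.Holds M W (mixVal v p) := by
  obtain ⟨p, τ, hτ⟩ := ht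
  obtain ⟨W, q, φ, hW, hφ⟩ := hP
  refine ⟨W, mixVal p q, τ.ren (mixVal (fun j => 2 * j) (fun j => 2 * (2 * j) + 1)),
    φ.ren (fun j => j) (mixVal (fun j => 2 * j) (fun j => 2 * (2 * j + 1) + 1)), hW,
    fun v => ?_, fun v => ?_⟩
  · rw [hτ, L2Term.val_ren, mixVal_ren v _ (fun j => j) (fun j => 2 * j)]
    simp only [mixVal_even]
  · rw [hφ, L2Bounded.holds_ren, mixVal_ren v _ (fun j => j) (fun j => 2 * j + 1)]
    simp only [mixVal_odd]

theorem IsTm.var (i : ℕ) : IsTm (M := M) (fun v => v i) :=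
  ⟨fun _ => 0, .var (2 * i), fun v => (mixVal_even v _ i).symm⟩

theorem IsTm.const (c : M.Num) : IsTm (M := M) (fun _ => c) :=
  ⟨fun _ => c, .var 1, fun _ => rfl⟩

theorem IsTm.add {s t : (ℕ → M.Num) → M.Num} (hs : IsTm s) (ht : IsTm t) :
    IsTm (fun v => s v + t v) := by
  obtain ⟨p, σ, τ, hσ, hτ⟩ := hs.common ht
  exact ⟨p, .add σ τ, fun v => by simp only [L2Term.val, hσ, hτ]⟩

theorem IsTm.mul {s t : (ℕ → M.Num) → M.Num} (hs : IsTm s) (ht : IsTm t) :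
    IsTm (fun v => s v * t v) := by
  obtain ⟨p, σ, τ, hσ, hτ⟩ := hs.common ht
  exact ⟨p, .mul σ τ, fun v => by simp only [L2Term.val, hσ, hτ]⟩

/-- The formula has no set variable, but a valuation of the set variables by sets of `M` is still
required, whence the nonemptiness. -/
theorem D0.eq (hne : M.sets.Nonempty) {s t : (ℕ → M.Num) → M.Num} (hs : IsTm s) (ht : IsTm t) :
    D0 (fun v => s v = t v) := by
  obtain ⟨p, σ, τ, hσ, hτ⟩ := hs.common ht
  obtain ⟨X, hX⟩ := hne
  exact ⟨fun _ => X, p, .eq σ τ, fun _ => hX, fun v => by simp only [L2Bounded.Holds, hσ, hτ]⟩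

theorem D0.lt (hne : M.sets.Nonempty) {s t : (ℕ → M.Num) → M.Num} (hs : IsTm s) (ht : IsTm t) :
    D0 (fun v => s v < t v) := by
  obtain ⟨p, σ, τ, hσ, hτ⟩ := hs.common ht
  obtain ⟨X, hX⟩ := hne
  exact ⟨fun _ => X, p, .lt σ τ, fun _ => hX, fun v => by simp only [L2Bounded.Holds, hσ, hτ]⟩

theorem D0.mem {X : Set M.Num} (hX : X ∈ M.sets) {s : (ℕ → M.Num) → M.Num} (hs : IsTm s) :
    D0 (fun v => s v ∈ X) := by
  obtain ⟨p, σ, hσ⟩ := hs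
  exact ⟨fun _ => X, p, .mem σ 0, fun _ => hX, fun v => by simp only [L2Bounded.Holds, hσ]⟩

theorem D0.not {P : (ℕ → M.Num) → Prop} (hP : D0 P) : D0 (fun v => ¬ P v) := by
  obtain ⟨W, p, φ, hW, hφ⟩ := hP
  exact ⟨W, p, .not φ, hW, fun v => by simp only [L2Bounded.Holds, hφ]⟩

theorem D0.and {P Q : (ℕ → M.Num) → Prop} (hP : D0 P) (hQ : D0 Q) :
    D0 (fun v => P v ∧ Q v) := by
  obtain ⟨W, p, φ, ψ, hW, hφ, hψ⟩ := hP.common hQ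
  exact ⟨W, p, .and φ ψ, hW, fun v => by simp only [L2Bounded.Holds, hφ, hψ]⟩

theorem D0.or {P Q : (ℕ → M.Num) → Prop} (hP : D0 P) (hQ : D0 Q) :
    D0 (fun v => P v ∨ Q v) := by
  obtain ⟨W, p, φ, ψ, hW, hφ, hψ⟩ := hP.common hQ
  exact ⟨W, p, .or φ ψ, hW, fun v => by simp only [L2Bounded.Holds, hφ, hψ]⟩

theorem D0.ball {t : (ℕ → M.Num) → M.Num} {P : M.Num → (ℕ → M.Num) → Prop} (ht : IsTm t)
    (hP : D0 (fun v => P (v 0) (tailVal v))) : D0 (fun v => ∀ a, a < t v → P a v) := by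
  obtain ⟨W, p, τ, φ, hW, hτ, hφ⟩ := D0.common_tm ht hP
  refine ⟨W, p, .ball τ (φ.ren (fun j => j) bindRen), hW, fun v => ?_⟩
  simp only [L2Bounded.Holds, hτ, L2Bounded.holds_ren, mixVal_consVal, ← hφ]
  rfl

theorem D0.bex {t : (ℕ → M.Num) → M.Num} {P : M.Num → (ℕ → M.Num) → Prop} (ht : IsTm t)
    (hP : D0 (fun v => P (v 0) (tailVal v))) : D0 (fun v => ∃ a, a < t v ∧ P a v) := by
  obtain ⟨W, p, τ, φ, hW, hτ, hφ⟩ := D0.common_tm ht hP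
  refine ⟨W, p, .bex τ (φ.ren (fun j => j) bindRen), hW, fun v => ?_⟩
  simp only [L2Bounded.Holds, hτ, L2Bounded.holds_ren, mixVal_consVal, ← hφ]
  rfl

theorem IsTm.ren (f : ℕ → ℕ) {t : (ℕ → M.Num) → M.Num} (ht : IsTm t) :
    IsTm (fun v => t (fun i => v (f i))) := by
  obtain ⟨p, τ, hτ⟩ := ht
  refine ⟨p, τ.ren (mixVal (fun j => 2 * f j) (fun j => 2 * j + 1)), fun v => ?_⟩
  rw [L2Term.val_ren, mixVal_ren v p f (fun j => j)]
  exact hτ _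

theorem D0.ren (f : ℕ → ℕ) {P : (ℕ → M.Num) → Prop} (hP : D0 P) :
    D0 (fun v => P (fun i => v (f i))) := by
  obtain ⟨W, p, φ, hW, hφ⟩ := hP
  refine ⟨W, p, φ.ren (fun j => j) (mixVal (fun j => 2 * f j) (fun j => 2 * j + 1)), hW,
    fun v => ?_⟩
  rw [L2Bounded.holds_ren, mixVal_ren v p f (fun j => j)]
  exact hφ _

/-- The renaming which turns `(a, n, …; p)` into `(a, n, p)`. -/
def closeRen : ℕ → ℕ :=
  mixVal (fun j => match j with
    | 0 => 0
    | 1 => 1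
    | _ => 2) (fun j => j + 2)

/-- Only the first two variables matter in the intended use; all others are given the dummy value `p
0`, which is present in the valuation at index `2`. -/
theorem mixVal_closeRen {α : Type u} (a n : α) (p : ℕ → α) :
    (fun i => consVal a (consVal n p) (closeRen i)) =
      mixVal (consVal a (consVal n fun _ => p 0)) p := by
  funext i
  rcases Nat.even_or_odd' i with ⟨k, rfl | rfl⟩
  · simp only [mixVal_even, closeRen]
    match k with
    | 0 => rfl
    | 1 => rfl
    | k + 2 => rfl
  · simp only [mixVal_odd, closeRen]
    rfl

theorem D0.exists_formula {P : M.Num → M.Num → Prop} (hP : D0 (fun v => P (v 0) (v 1))) :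
    ∃ (φ : L2Bounded) (v : ℕ → M.Num) (W : ℕ → Set M.Num), (∀ i, W i ∈ M.sets) ∧
      ∀ a n, P a n ↔ φ.Holds M W (consVal a (consVal n v)) := by
  obtain ⟨W, p, φ, hW, hφ⟩ := hP
  refine ⟨φ.ren (fun j => j) closeRen, p, W, hW, fun a n => ?_⟩
  rw [L2Bounded.holds_ren, mixVal_closeRen, ← hφ]
  rfl

theorem D0.isSigma01 {P : M.Num → M.Num → Prop} (hP : D0 (fun v => P (v 0) (v 1))) :
    M.IsSigma01 (fun n => ∃ a, P a n) := by
  obtain ⟨φ, v, W, hW, h⟩ := hP.exists_formula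
  exact ⟨φ, v, W, hW, fun n => exists_congr fun a => h a n⟩

theorem D0.isPi01 {P : M.Num → M.Num → Prop} (hP : D0 (fun v => P (v 0) (v 1))) :
    M.IsPi01 (fun n => ∀ a, P a n) := by
  obtain ⟨φ, v, W, hW, h⟩ := hP.exists_formula
  exact ⟨φ, v, W, hW, fun n => forall_congr' fun a => h a n⟩

/-! ### Arithmetic in a model of `RCA₀` -/

/-- A model of `RCA₀` with at least one set. -/
class Model (M : L2Structure.{u}) : Prop where
  isModel : M.IsModelRCA0
  nonempty : M.sets.Nonempty

section Arithmetic

variable [hM : Model M]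

theorem sigma_induction {P : M.Num → M.Num → Prop} (hP : D0 (fun v => P (v 0) (v 1)))
    (h0 : ∃ a, P a 0) (h1 : ∀ n, (∃ a, P a n) → ∃ a, P a (n + 1)) (n : M.Num) : ∃ a, P a n :=
  hM.isModel.sigma01_induction _ hP.isSigma01 h0 h1 n

theorem D0.induction {P : M.Num → Prop} (hP : D0 (fun v => P (v 0)))
    (h0 : P 0) (h1 : ∀ n, P n → P (n + 1)) (n : M.Num) : P n := by
  obtain ⟨_, h⟩ := sigma_induction (P := fun _ n => P n) (hP.ren (fun i => i + 1)) ⟨0, h0⟩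
    (fun n ⟨a, h⟩ => ⟨a, h1 n h⟩) n
  exact h

namespace Num

theorem zero_add (n : M.Num) : 0 + n = n := by
  refine D0.induction (P := fun n => 0 + n = n)
    (.eq hM.nonempty (.add (.const 0) (.var 0)) (.var 0)) (hM.isModel.add_zero 0) (fun n h => ?_) n
  rw [hM.isModel.add_succ, h]

theorem succ_add (m n : M.Num) : (m + 1) + n = (m + n) + 1 := by
  refine D0.induction (P := fun n => (m + 1) + n = (m + n) + 1)
    (.eq hM.nonempty (.add (.const _) (.var 0)) (.add (.add (.const m) (.var 0)) (.const 1)))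
    ?_ (fun n h => ?_) n
  · rw [hM.isModel.add_zero, hM.isModel.add_zero]
  · rw [hM.isModel.add_succ, hM.isModel.add_succ, h]

theorem add_comm (m n : M.Num) : m + n = n + m := by
  refine D0.induction (P := fun n => m + n = n + m)
    (.eq hM.nonempty (.add (.const _) (.var 0)) (.add (.var 0) (.const m))) ?_ (fun n h => ?_) n
  · rw [hM.isModel.add_zero, zero_add]
  · rw [hM.isModel.add_succ, succ_add, h]

theorem add_assoc (a b c : M.Num) : a + b + c = a + (b + c) := by
  refine D0.induction (P := fun c => a + b + c = a + (b + c))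
    (.eq hM.nonempty (.add (.const _) (.var 0)) (.add (.const a) (.add (.const b) (.var 0))))
    ?_ (fun n h => ?_) c
  · rw [hM.isModel.add_zero, hM.isModel.add_zero]
  · rw [hM.isModel.add_succ, hM.isModel.add_succ, hM.isModel.add_succ, h]

theorem zero_mul (n : M.Num) : 0 * n = 0 := by
  refine D0.induction (P := fun n => 0 * n = 0)
    (.eq hM.nonempty (.mul (.const 0) (.var 0)) (.const 0)) (hM.isModel.mul_zero 0)
    (fun n h => ?_) n
  rw [hM.isModel.mul_succ, h, zero_add]

theorem succ_mul (m n : M.Num) : (m + 1) * n = m * n + n := by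
  refine D0.induction (P := fun n => (m + 1) * n = m * n + n)
    (.eq hM.nonempty (.mul (.const _) (.var 0)) (.add (.mul (.const m) (.var 0)) (.var 0)))
    ?_ (fun n h => ?_) n
  · rw [hM.isModel.mul_zero, hM.isModel.mul_zero, zero_add]
  · rw [hM.isModel.mul_succ, hM.isModel.mul_succ, h, hM.isModel.add_succ _ m,
      hM.isModel.add_succ _ n, add_assoc (m * n) n m,
      add_assoc (m * n) m n, add_comm n m]

theorem mul_comm (m n : M.Num) : m * n = n * m := by
  refine D0.induction (P := fun n => m * n = n * m)
    (.eq hM.nonempty (.mul (.const _) (.var 0)) (.mul (.var 0) (.const m))) ?_ (fun n h => ?_) n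
  · rw [hM.isModel.mul_zero, zero_mul]
  · rw [hM.isModel.mul_succ, succ_mul, h]

theorem mul_add (a b c : M.Num) : a * (b + c) = a * b + a * c := by
  refine D0.induction (P := fun c => a * (b + c) = a * b + a * c)
    (.eq hM.nonempty (.mul (.const a) (.add (.const b) (.var 0)))
      (.add (.const _) (.mul (.const a) (.var 0)))) ?_ (fun n h => ?_) c
  · rw [hM.isModel.mul_zero, hM.isModel.add_zero, hM.isModel.add_zero]
  · rw [hM.isModel.add_succ, hM.isModel.mul_succ, hM.isModel.mul_succ, h, add_assoc]

theorem mul_assoc (a b c : M.Num) : a * b * c = a * (b * c) := by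
  refine D0.induction (P := fun c => a * b * c = a * (b * c))
    (.eq hM.nonempty (.mul (.const _) (.var 0)) (.mul (.const a) (.mul (.const b) (.var 0))))
    ?_ (fun n h => ?_) c
  · rw [hM.isModel.mul_zero, hM.isModel.mul_zero, hM.isModel.mul_zero]
  · rw [hM.isModel.mul_succ, hM.isModel.mul_succ, h, mul_add]

theorem one_mul (n : M.Num) : 1 * n = n := by
  rw [← zero_add (1 : M.Num), succ_mul, zero_mul, zero_add]

theorem add_right_cancel (a b c : M.Num) (h : a + c = b + c) : a = b := by
  have := D0.induction (P := fun c => ¬ a + c = b + c ∨ a = b)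
    (.or (.not (.eq hM.nonempty (.add (.const a) (.var 0)) (.add (.const b) (.var 0))))
      (.eq hM.nonempty (.const a) (.const b))) ?_ (fun n h => ?_) c
  · exact this.resolve_left (not_not.2 h)
  · rw [hM.isModel.add_zero, hM.isModel.add_zero]
    exact (em _).symm
  · refine h.imp_left fun h h' => h ?_
    rw [hM.isModel.add_succ, hM.isModel.add_succ] at h'
    exact hM.isModel.succ_inj _ _ h'

theorem lt_add_succ (m k : M.Num) : m < m + (k + 1) := by
  refine D0.induction (P := fun k => m < m + (k + 1))
    (.lt hM.nonempty (.const _) (.add (.const m) (.add (.var 0) (.const 1)))) ?_ (fun n h => ?_) k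
  · rw [zero_add]
    exact (hM.isModel.lt_succ_iff _ _).2 (.inr rfl)
  · rw [hM.isModel.add_succ]
    exact (hM.isModel.lt_succ_iff _ _).2 (.inl h)

theorem lt_iff_exists (m n : M.Num) : m < n ↔ ∃ k, m + (k + 1) = n := by
  refine ⟨fun h => ?_, ?_⟩
  -- The difference `k` is the unbounded witness of a `Σ⁰₁` induction on `n`; the implication is
  -- written as a disjunction so that the matrix stays a bounded formula.
  · have := sigma_induction (P := fun k n => ¬ m < n ∨ m + (k + 1) = n)
      (.or (.not (.lt hM.nonempty (.const _) (.var 1)))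
        (.eq hM.nonempty (.add (.const m) (.add (.var 0) (.const 1))) (.var 1))) ?_ (fun n h => ?_) n
    · obtain ⟨k, hk⟩ := this
      exact ⟨k, hk.resolve_left (not_not.2 h)⟩
    · exact ⟨0, .inl (hM.isModel.not_lt_zero _)⟩
    · obtain ⟨k, hk⟩ := h
      by_cases hmn : m < n
      · refine ⟨k + 1, .inr ?_⟩
        rw [hM.isModel.add_succ, hk.resolve_left (not_not.2 hmn)]
      · by_cases hmn' : m = n
        · subst hmn'
          exact ⟨0, .inr (by rw [zero_add])⟩
        · refine ⟨0, .inl fun h => ?_⟩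
          rcases (hM.isModel.lt_succ_iff _ _).1 h with h | h
          exacts [hmn h, hmn' h]
  · rintro ⟨k, rfl⟩
    exact lt_add_succ m k

theorem eq_zero_or_succ (n : M.Num) : n = 0 ∨ ∃ k, n = k + 1 := by
  by_cases h : n = 0
  · exact .inl h
  · have h0 : ∀ n : M.Num, 0 < n ∨ n = 0 := D0.induction
      (.or (.lt hM.nonempty (.const _) (.var 0)) (.eq hM.nonempty (.var 0) (.const 0))) (.inr rfl)
      fun n h => .inl ((hM.isModel.lt_succ_iff _ _).2 (h.imp_right Eq.symm))
    obtain ⟨k, hk⟩ := (lt_iff_exists _ _).1 ((h0 n).resolve_right h)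
    exact .inr ⟨k, by rw [← hk, zero_add]⟩

theorem le_iff_exists (m n : M.Num) : (m < n ∨ m = n) ↔ ∃ k, n = m + k := by
  rw [lt_iff_exists]
  constructor
  · rintro (⟨k, rfl⟩ | rfl)
    · exact ⟨_, rfl⟩
    · exact ⟨0, (hM.isModel.add_zero _).symm⟩
  · rintro ⟨k, rfl⟩
    rcases eq_zero_or_succ k with rfl | ⟨k, rfl⟩
    · exact .inr (hM.isModel.add_zero _).symm
    · exact .inl ⟨k, rfl⟩

theorem lt_irrefl (m : M.Num) : ¬ m < m := by
  rw [lt_iff_exists]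
  rintro ⟨k, hk⟩
  refine hM.isModel.succ_ne_zero k (add_right_cancel _ _ m ?_)
  rw [add_comm, hk, zero_add]

theorem lt_trans {a b c : M.Num} (h : a < b) (h' : b < c) : a < c := by
  rw [lt_iff_exists] at *
  obtain ⟨k, rfl⟩ := h
  obtain ⟨l, rfl⟩ := h'
  exact ⟨k + 1 + l, by rw [add_assoc, ← add_assoc]⟩

theorem lt_trichotomy (a b : M.Num) : (a < b ∨ a = b) ∨ (b < a ∨ b = a) := by
  refine D0.induction (P := fun b => (a < b ∨ a = b) ∨ (b < a ∨ b = a))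
    (.or (.or (.lt hM.nonempty (.const _) (.var 0)) (.eq hM.nonempty (.const _) (.var 0)))
      (.or (.lt hM.nonempty (.var 0) (.const _)) (.eq hM.nonempty (.var 0) (.const _))))
    ?_ (fun n h => ?_) b
  · rcases eq_zero_or_succ a with rfl | ⟨k, rfl⟩
    · exact .inl (.inr rfl)
    · exact .inr ((le_iff_exists _ _).2 ⟨k + 1, (zero_add _).symm⟩)
  · rcases h with h | h | rfl
    · exact .inl (.inl ((hM.isModel.lt_succ_iff _ _).2 h))
    · obtain ⟨k, rfl⟩ := (lt_iff_exists _ _).1 h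
      exact .inr ((le_iff_exists _ _).2 ⟨k, by rw [add_assoc, add_comm 1 k]⟩)
    · exact .inl (.inl ((hM.isModel.lt_succ_iff _ _).2 (.inr rfl)))

end Num

/-! ### The numbers as an ordered commutative semiring -/

instance : CommSemiring M.Num where
  add := (· + ·)
  zero := 0
  mul := (· * ·)
  one := 1
  add_assoc := Num.add_assoc
  zero_add := Num.zero_add
  add_zero := hM.isModel.add_zero
  add_comm := Num.add_comm
  left_distrib := Num.mul_add
  right_distrib a b c := by
    change (a + b) * c = a * c + b * c
    rw [Num.mul_comm, Num.mul_add, Num.mul_comm c, Num.mul_comm c]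
  zero_mul := Num.zero_mul
  mul_zero := hM.isModel.mul_zero
  mul_assoc := Num.mul_assoc
  one_mul := Num.one_mul
  mul_one a := by
    change a * 1 = a
    rw [Num.mul_comm, Num.one_mul]
  mul_comm := Num.mul_comm
  nsmul := nsmulRec
  npow := npowRec

noncomputable instance : LinearOrder M.Num where
  lt := (· < ·)
  le a b := a < b ∨ a = b
  le_refl _ := .inr rfl
  le_trans a b c := by
    rintro (h | rfl) (h' | rfl)
    exacts [.inl (Num.lt_trans h h'), .inl h, .inl h', .inr rfl]
  lt_iff_le_not_ge a b := by
    constructor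
    · intro h
      refine ⟨.inl h, ?_⟩
      rintro (h' | rfl)
      exacts [Num.lt_irrefl _ (Num.lt_trans h h'), Num.lt_irrefl _ h]
    · rintro ⟨h | rfl, h'⟩
      exacts [h, (h' (.inr rfl)).elim]
  le_antisymm a b := by
    rintro (h | rfl) (h' | h')
    exacts [(Num.lt_irrefl _ (Num.lt_trans h h')).elim, h'.symm, rfl, rfl]
  le_total := Num.lt_trichotomy
  toDecidableLE := Classical.decRel _

theorem le_iff_exists_eq_add {m n : M.Num} : m ≤ n ↔ ∃ k, n = m + k := Num.le_iff_exists m n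

instance : IsCancelAdd M.Num where
  add_left_cancel a b c h := Num.add_right_cancel b c a (by
    rw [add_comm b, add_comm c]; exact h)
  add_right_cancel a b c h := Num.add_right_cancel b c a h

instance : CanonicallyOrderedAdd M.Num where
  exists_add_of_le h := le_iff_exists_eq_add.1 h
  le_add_self _ b := le_iff_exists_eq_add.2 ⟨b, add_comm _ _⟩
  le_self_add _ b := le_iff_exists_eq_add.2 ⟨b, rfl⟩

instance : Nontrivial M.Num := ⟨⟨0, 1, fun h => hM.isModel.succ_ne_zero 0 (by
  rw [Num.zero_add]; exact h.symm)⟩⟩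

theorem add_one_ne_zero (n : M.Num) : n + 1 ≠ 0 := hM.isModel.succ_ne_zero n

theorem lt_add_one_iff {m n : M.Num} : m < n + 1 ↔ m ≤ n := hM.isModel.lt_succ_iff m n

theorem lt_iff_exists_add {m n : M.Num} : m < n ↔ ∃ k, n = m + k + 1 := by
  refine (Num.lt_iff_exists m n).trans (exists_congr fun k => ?_)
  rw [← add_assoc, eq_comm]

theorem add_one_le_iff {m n : M.Num} : m + 1 ≤ n ↔ m < n := by
  rw [le_iff_exists_eq_add, lt_iff_exists_add]
  exact exists_congr fun k => by rw [add_right_comm]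

instance : IsOrderedCancelAddMonoid M.Num where
  add_le_add_left a b h c := by
    obtain ⟨k, rfl⟩ := le_iff_exists_eq_add.1 h
    exact le_iff_exists_eq_add.2 ⟨k, by ring⟩
  le_of_add_le_add_left a b c h := by
    obtain ⟨k, hk⟩ := le_iff_exists_eq_add.1 h
    exact le_iff_exists_eq_add.2 ⟨k, add_left_cancel (hk.trans (add_assoc _ _ _))⟩

theorem mul_lt_mul_of_pos (a b c : M.Num) (ha : 0 < a) (h : b < c) : a * b < a * c := by
  obtain ⟨k, rfl⟩ := lt_iff_exists_add.1 h
  obtain ⟨l, rfl⟩ := lt_iff_exists_add.1 ha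
  exact lt_iff_exists_add.2 ⟨l * k + l + k, by ring⟩

instance : IsStrictOrderedRing M.Num where
  zero_le_one := zero_le
  mul_lt_mul_of_pos_left a ha b c h := mul_lt_mul_of_pos a b c ha h
  mul_lt_mul_of_pos_right a ha b c h := by
    simpa only [mul_comm] using mul_lt_mul_of_pos a b c ha h

end Arithmetic
end L2Structure

namespace L2Structure

variable {M : L2Structure.{u}}

/-! ### `Σ⁰₁` and `Δ⁰₁` predicates of valuations, and functions with a `Σ⁰₁` graph -/

theorem apply_mixVal {α β : Type*} (f : α → β) (a b : ℕ → α) (i : ℕ) :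
    f (mixVal a b i) = mixVal (fun i => f (a i)) (fun i => f (b i)) i := by
  unfold mixVal
  split_ifs <;> rfl

/-- Values of variables are turned into parameters: `v` is interleaved with the old parameter
sequence. This makes one-variable induction available inside an arbitrary context. -/
theorem D0.fix {P : (ℕ → M.Num) → Prop} (hP : D0 P) (v : ℕ → M.Num) (g : ℕ → ℕ) :
    D0 (fun w => P (fun i => mixVal w v (g i))) := by
  obtain ⟨W, p, φ, hW, hφ⟩ := hP.ren g
  refine ⟨W, mixVal v p, φ.ren (fun j => j) (mixVal (mixVal (fun j => 2 * j)
    (fun j => 2 * (2 * j) + 1)) (fun j => 2 * (2 * j + 1) + 1)), hW, fun w => ?_⟩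
  rw [L2Bounded.holds_ren, hφ (mixVal w v)]
  simp only [apply_mixVal, mixVal_even, mixVal_odd]

theorem D0.section_consVal {Q : M.Num → (ℕ → M.Num) → Prop}
    (hQ : D0 (fun v => Q (v 0) (tailVal v))) (v : ℕ → M.Num) :
    D0 (fun w => Q (w 0) (consVal (w 1) v)) := by
  have := hQ.fix v (fun i => match i with | 0 => 0 | 1 => 2 | i + 2 => 2 * i + 1)
  convert this using 3 with w
  · exact (mixVal_even w v 0).symm
  · funext i
    cases i with
    | zero => exact (mixVal_even w v 1).symm
    | succ i => exact (mixVal_odd w v i).symm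

/-- `P` is `Σ⁰₁` with parameters. -/
class Sig (P : (ℕ → M.Num) → Prop) : Prop where
  out : ∃ Q : M.Num → (ℕ → M.Num) → Prop, D0 (fun v => Q (v 0) (tailVal v)) ∧
    ∀ v, P v ↔ ∃ a, Q a v

/-- `P` is `Δ⁰₁` with parameters. -/
class Rec (P : (ℕ → M.Num) → Prop) : Prop where
  sig : Sig P
  nsig : Sig (fun v => ¬ P v)

/-- The graph of `t` is `Σ⁰₁` with parameters. -/
class RecFun (t : (ℕ → M.Num) → M.Num) : Prop where
  sig : Sig (fun v => v 0 = t (tailVal v))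

attribute [instance] Rec.sig

theorem Sig.congr {P Q : (ℕ → M.Num) → Prop} (hP : Sig P) (h : ∀ v, Q v ↔ P v) : Sig Q := by
  rwa [show Q = P from funext fun v => propext (h v)]

theorem Rec.congr {P Q : (ℕ → M.Num) → Prop} (hP : Rec P) (h : ∀ v, Q v ↔ P v) : Rec Q := by
  rwa [show Q = P from funext fun v => propext (h v)]

theorem D0.sig {P : (ℕ → M.Num) → Prop} (hP : D0 P) : Sig P :=
  ⟨fun _ v => P v, hP.ren (fun i => i + 1), fun _ => ⟨fun h => ⟨0, h⟩, fun ⟨_, h⟩ => h⟩⟩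

theorem D0.rec {P : (ℕ → M.Num) → Prop} (hP : D0 P) : Rec P := ⟨hP.sig, hP.not.sig⟩

theorem Sig.ren (f : ℕ → ℕ) {P : (ℕ → M.Num) → Prop} (hP : Sig P) :
    Sig (fun v => P (fun i => v (f i))) := by
  obtain ⟨Q, hQ, h⟩ := hP.out
  exact ⟨fun a v => Q a (fun i => v (f i)), hQ.ren (liftRen f), fun v => h _⟩

theorem Sig.fix {P : M.Num → (ℕ → M.Num) → Prop} (hP : Sig (fun v => P (v 0) (tailVal v)))
    (v : ℕ → M.Num) : Sig (fun w => P (w 0) v) := by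
  obtain ⟨Q, hQ, h⟩ := hP.out
  exact ⟨fun a w => Q a (consVal (w 0) v), hQ.section_consVal v, fun w => h (consVal (w 0) v)⟩

theorem Rec.ren (f : ℕ → ℕ) {P : (ℕ → M.Num) → Prop} (hP : Rec P) :
    Rec (fun v => P (fun i => v (f i))) := ⟨hP.sig.ren f, hP.nsig.ren f⟩

theorem RecFun.ren (f : ℕ → ℕ) {t : (ℕ → M.Num) → M.Num} (ht : RecFun t) :
    RecFun (fun v => t (fun i => v (f i))) := ⟨ht.sig.ren (liftRen f)⟩

/-- The renaming which inserts a variable at index `2`. -/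
def skipRen : ℕ → ℕ
  | 0 => 0
  | 1 => 1
  | i + 2 => i + 3

theorem consVal_skipRen (w : ℕ → M.Num) :
    tailVal (fun i => w (skipRen i)) = consVal (w 1) (tailVal (tailVal (tailVal w))) := by
  funext i
  cases i <;> rfl

/-! ### Closure properties of `Σ⁰₁` and `Δ⁰₁` predicates -/

instance Sig.or {P Q : (ℕ → M.Num) → Prop} [hP : Sig P] [hQ : Sig Q] :
    Sig (fun v => P v ∨ Q v) := by
  obtain ⟨P', hP', h⟩ := hP.out
  obtain ⟨Q', hQ', h'⟩ := hQ.out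
  refine ⟨fun c v => P' c v ∨ Q' c v, .or hP' hQ', fun v => ?_⟩
  simp only [h, h', exists_or]

instance Rec.not {P : (ℕ → M.Num) → Prop} [hP : Rec P] : Rec (fun v => ¬ P v) :=
  ⟨hP.nsig, by simpa only [not_not] using hP.sig⟩

theorem Sig.isSigma01 {P : M.Num → Prop} (hP : Sig (fun v => P (v 0))) : M.IsSigma01 P := by
  obtain ⟨Q, hQ, h⟩ := hP.out
  have := D0.isSigma01 (P := fun a n => Q a (fun _ => n))
    (hQ.ren (fun i => match i with | 0 => 0 | _ + 1 => 1))
  convert this using 2 with n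
  exact h fun _ => n

section

variable [hM : Model M]

/-- The two unbounded witnesses are replaced by one common strict bound, so no decoding of pairs is
needed. -/
instance Sig.and {P Q : (ℕ → M.Num) → Prop} [hP : Sig P] [hQ : Sig Q] :
    Sig (fun v => P v ∧ Q v) := by
  obtain ⟨P', hP', h⟩ := hP.out
  obtain ⟨Q', hQ', h'⟩ := hQ.out
  refine ⟨fun c v => (∃ a, a < c ∧ P' a v) ∧ ∃ a, a < c ∧ Q' a v,
    .and (.bex (.var 0) (hP'.ren (fun i => match i with | 0 => 0 | i + 1 => i + 2)))
      (.bex (.var 0) (hQ'.ren (fun i => match i with | 0 => 0 | i + 1 => i + 2))), fun v => ?_⟩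
  simp only [h, h']
  constructor
  · rintro ⟨⟨a, ha⟩, b, hb⟩
    exact ⟨a + b + 1, ⟨a, lt_add_one_iff.2 le_self_add, ha⟩, b, lt_add_one_iff.2 le_add_self, hb⟩
  · rintro ⟨c, ⟨a, -, ha⟩, b, -, hb⟩
    exact ⟨⟨a, ha⟩, b, hb⟩

instance Sig.ex {P : M.Num → (ℕ → M.Num) → Prop} [hP : Sig (fun v => P (v 0) (tailVal v))] :
    Sig (fun v => ∃ a, P a v) := by
  obtain ⟨Q, hQ, h⟩ := hP.out
  refine ⟨fun c v => ∃ x, x < c ∧ ∃ a, a < c ∧ Q a (consVal x v),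
    .bex (.var 0) (.bex (.var 1) ?_), fun v => ?_⟩
  · have := hQ.ren skipRen
    simp only [consVal_skipRen] at this
    exact this
  · have h' : ∀ x, P x v ↔ ∃ a, Q a (consVal x v) := fun x => h (consVal x v)
    simp only [h']
    constructor
    · rintro ⟨x, a, ha⟩
      exact ⟨x + a + 1, x, lt_add_one_iff.2 le_self_add, a, lt_add_one_iff.2 le_add_self, ha⟩
    · rintro ⟨c, x, -, a, -, ha⟩
      exact ⟨x, a, ha⟩

/-- This is `Σ⁰₁` collection: a single bound for the witnesses of all `a < t v` is found by `Σ⁰₁`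
induction on initial segments. -/
theorem Sig.ball_tm {P : M.Num → (ℕ → M.Num) → Prop} (hP : Sig (fun v => P (v 0) (tailVal v)))
    {t : (ℕ → M.Num) → M.Num} (ht : IsTm t) : Sig (fun v => ∀ a, a < t v → P a v) := by
  obtain ⟨Q, hQ, h⟩ := hP.out
  refine ⟨fun c v => ∀ x, x < t v → ∃ a, a < c ∧ Q a (consVal x v),
    .ball (ht.ren (fun i => i + 1)) (.bex (.var 1) ?_), fun v => ?_⟩
  · have := hQ.ren skipRen
    simp only [consVal_skipRen] at this
    exact this
  · have h' : ∀ x, P x v ↔ ∃ a, Q a (consVal x v) := fun x => h (consVal x v)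
    simp only [h']
    constructor
    · intro hx
      -- The guard restricts the claim to `n ≤ t v`, since witnesses are only known to exist below
      -- `t v`.
      have := sigma_induction (P := fun b n => ¬ n < t v + 1 ∨
          ∀ x, x < n → ∃ a, a < b ∧ Q a (consVal x v))
        (.or (.not (.lt hM.nonempty (.var 1) (.const _))) (.ball (.var 1) (.bex (.var 1) ?_)))
        ⟨0, .inr fun x hx => (hM.isModel.not_lt_zero _ hx).elim⟩ ?_ (t v)
      · obtain ⟨b, hb⟩ := this
        exact ⟨b, hb.resolve_left (not_not.2 (lt_add_one _))⟩
      · exact hQ.section_consVal v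
      · rintro n ⟨b, hb⟩
        by_cases hn : n < t v
        · obtain ⟨a, ha⟩ := hx n hn
          have hb' := hb.resolve_left (not_not.2 (hn.trans (lt_add_one _)))
          refine ⟨b + a + 1, .inr fun x hx => ?_⟩
          rcases (lt_add_one_iff.1 hx).lt_or_eq with hx | rfl
          · obtain ⟨a', ha', h⟩ := hb' x hx
            exact ⟨a', ha'.trans_le (le_self_add.trans (lt_add_one _).le), h⟩
          · exact ⟨a, lt_add_one_iff.2 le_add_self, ha⟩
        · exact ⟨0, .inl fun h => hn (lt_of_add_lt_add_right h)⟩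
    · rintro ⟨b, hb⟩ x hx
      obtain ⟨a, -, ha⟩ := hb x hx
      exact ⟨a, ha⟩

theorem IsTm.recFun {t : (ℕ → M.Num) → M.Num} (ht : IsTm t) : RecFun t :=
  ⟨(D0.eq hM.nonempty (.var 0) (ht.ren fun i => i + 1)).sig⟩

instance RecFun.var (i : ℕ) : RecFun (fun v : ℕ → M.Num => v i) := (IsTm.var i).recFun

instance RecFun.const (c : M.Num) : RecFun (fun _ : ℕ → M.Num => c) := (IsTm.const c).recFun

/-- A function with a `Σ⁰₁` graph is substituted through its graph, as `∃ a, a = s v ∧ P a v`. -/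
theorem Sig.subst {P : M.Num → (ℕ → M.Num) → Prop} (hP : Sig (fun v => P (v 0) (tailVal v)))
    {s : (ℕ → M.Num) → M.Num} (hs : RecFun s) : Sig (fun v => P (s v) v) := by
  have := hs.sig
  exact (inferInstance : Sig fun v => ∃ a, a = s v ∧ P a v).congr fun v => by simp

theorem Sig.comp1 {P : M.Num → Prop} (hP : Sig (fun v => P (v 0)))
    {s : (ℕ → M.Num) → M.Num} (hs : RecFun s) : Sig (fun v => P (s v)) :=
  Sig.subst (P := fun a _ => P a) hP hs

theorem Sig.comp2 {P : M.Num → M.Num → Prop} (hP : Sig (fun v => P (v 0) (v 1)))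
    {s t : (ℕ → M.Num) → M.Num} (hs : RecFun s) (ht : RecFun t) :
    Sig (fun v => P (s v) (t v)) :=
  Sig.subst (P := fun a v => P a (t v)) (Sig.subst (P := fun a v => P (v 0) a)
    (hP.ren fun i => 1 - i) (ht.ren fun i => i + 1)) hs

theorem Sig.comp3 {P : M.Num → M.Num → M.Num → Prop} (hP : Sig (fun v => P (v 0) (v 1) (v 2)))
    {r s t : (ℕ → M.Num) → M.Num} (hr : RecFun r) (hs : RecFun s) (ht : RecFun t) :
    Sig (fun v => P (r v) (s v) (t v)) :=
  Sig.subst (P := fun a v => P a (s v) (t v)) (Sig.subst (P := fun a v => P (v 0) a (t (tailVal v)))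
    (Sig.subst (P := fun a v => P (v 1) (v 0) a) (hP.ren fun i => 2 - i) (ht.ren fun i => i + 2))
    (hs.ren fun i => i + 1)) hr

theorem Rec.comp1 {P : M.Num → Prop} (hP : Rec (fun v => P (v 0)))
    {s : (ℕ → M.Num) → M.Num} (hs : RecFun s) : Rec (fun v => P (s v)) :=
  ⟨hP.sig.comp1 hs, hP.nsig.comp1 (P := fun a => ¬ P a) hs⟩

theorem Rec.comp2 {P : M.Num → M.Num → Prop} (hP : Rec (fun v => P (v 0) (v 1)))
    {s t : (ℕ → M.Num) → M.Num} (hs : RecFun s) (ht : RecFun t) :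
    Rec (fun v => P (s v) (t v)) :=
  ⟨hP.sig.comp2 hs ht, hP.nsig.comp2 (P := fun a b => ¬ P a b) hs ht⟩

theorem Rec.comp3 {P : M.Num → M.Num → M.Num → Prop} (hP : Rec (fun v => P (v 0) (v 1) (v 2)))
    {r s t : (ℕ → M.Num) → M.Num} (hr : RecFun r) (hs : RecFun s) (ht : RecFun t) :
    Rec (fun v => P (r v) (s v) (t v)) :=
  ⟨hP.sig.comp3 hr hs ht, hP.nsig.comp3 (P := fun a b c => ¬ P a b c) hr hs ht⟩

theorem RecFun.comp1 {F : M.Num → M.Num} (hF : RecFun (fun v => F (v 0)))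
    {s : (ℕ → M.Num) → M.Num} (hs : RecFun s) : RecFun (fun v => F (s v)) :=
  ⟨Sig.comp2 (P := fun a b => a = F b) hF.sig (.var 0) (hs.ren fun i => i + 1)⟩

theorem RecFun.comp2 {F : M.Num → M.Num → M.Num} (hF : RecFun (fun v => F (v 0) (v 1)))
    {s t : (ℕ → M.Num) → M.Num} (hs : RecFun s) (ht : RecFun t) :
    RecFun (fun v => F (s v) (t v)) :=
  ⟨Sig.comp3 (P := fun a b c => a = F b c) hF.sig (.var 0) (hs.ren fun i => i + 1)
    (ht.ren fun i => i + 1)⟩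

instance RecFun.add {s t : (ℕ → M.Num) → M.Num} [hs : RecFun s] [ht : RecFun t] :
    RecFun (fun v => s v + t v) := .comp2 (F := (· + ·)) (IsTm.add (.var 0) (.var 1)).recFun hs ht

instance RecFun.mul {s t : (ℕ → M.Num) → M.Num} [hs : RecFun s] [ht : RecFun t] :
    RecFun (fun v => s v * t v) := .comp2 (F := (· * ·)) (IsTm.mul (.var 0) (.var 1)).recFun hs ht

instance RecFun.pair {s t : (ℕ → M.Num) → M.Num} [RecFun s] [RecFun t] :
    RecFun (fun v => pair (s v) (t v)) := by
  unfold L2Structure.pair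
  infer_instance

instance Rec.eq {s t : (ℕ → M.Num) → M.Num} [hs : RecFun s] [ht : RecFun t] :
    Rec (fun v => s v = t v) :=
  .comp2 (P := fun a b => a = b) (D0.eq hM.nonempty (.var 0) (.var 1)).rec hs ht

instance Rec.lt {s t : (ℕ → M.Num) → M.Num} [hs : RecFun s] [ht : RecFun t] :
    Rec (fun v => s v < t v) :=
  .comp2 (P := fun a b => a < b) (D0.lt hM.nonempty (.var 0) (.var 1)).rec hs ht

theorem Rec.mem {X : Set M.Num} (hX : X ∈ M.sets) {s : (ℕ → M.Num) → M.Num} (hs : RecFun s) :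
    Rec (fun v => s v ∈ X) :=
  .comp1 (P := fun a => a ∈ X) (D0.mem hX (.var 0)).rec hs

instance Rec.and {P Q : (ℕ → M.Num) → Prop} [hP : Rec P] [hQ : Rec Q] :
    Rec (fun v => P v ∧ Q v) :=
  ⟨inferInstance, (have := hP.nsig; have := hQ.nsig
    (inferInstance : Sig fun v => ¬ P v ∨ ¬ Q v).congr fun _ => not_and_or)⟩

instance Rec.or {P Q : (ℕ → M.Num) → Prop} [hP : Rec P] [hQ : Rec Q] :
    Rec (fun v => P v ∨ Q v) :=
  (inferInstance : Rec fun v => ¬ (¬ P v ∧ ¬ Q v)).congr fun v => by tauto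

instance Rec.imp {P Q : (ℕ → M.Num) → Prop} [hP : Rec P] [hQ : Rec Q] :
    Rec (fun v => P v → Q v) :=
  (inferInstance : Rec fun v => ¬ P v ∨ Q v).congr fun v => by tauto

instance Rec.iff {P Q : (ℕ → M.Num) → Prop} [hP : Rec P] [hQ : Rec Q] :
    Rec (fun v => P v ↔ Q v) :=
  (inferInstance : Rec fun v => (P v → Q v) ∧ (Q v → P v)).congr fun v => by tauto

instance Sig.imp {P Q : (ℕ → M.Num) → Prop} [hP : Rec P] [hQ : Sig Q] :
    Sig (fun v => P v → Q v) :=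
  have := hP.nsig
  (inferInstance : Sig fun v => ¬ P v ∨ Q v).congr fun v => by tauto

instance Sig.ball {P : M.Num → (ℕ → M.Num) → Prop} {t : (ℕ → M.Num) → M.Num} [ht : RecFun t]
    [hP : Sig (fun v => P (v 0) (tailVal v))] : Sig (fun v => ∀ a, a < t v → P a v) :=
  Sig.subst (P := fun b v => ∀ a, a < b → P a v)
    (Sig.ball_tm (hP.ren fun i => match i with | 0 => 0 | i + 1 => i + 2) (.var 0)) ht

instance Rec.ball {P : M.Num → (ℕ → M.Num) → Prop} {t : (ℕ → M.Num) → M.Num} [ht : RecFun t]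
    [hP : Rec (fun v => P (v 0) (tailVal v))] : Rec (fun v => ∀ a, a < t v → P a v) := by
  refine ⟨inferInstance, ?_⟩
  have := hP.nsig
  have := ht.ren fun i => i + 1
  exact (Sig.ex (P := fun a v => a < t v ∧ ¬ P a v)).congr fun v => by push Not; rfl

instance Rec.bex {P : M.Num → (ℕ → M.Num) → Prop} {t : (ℕ → M.Num) → M.Num} [ht : RecFun t]
    [hP : Rec (fun v => P (v 0) (tailVal v))] : Rec (fun v => ∃ a, a < t v ∧ P a v) :=
  (inferInstance : Rec fun v => ¬ ∀ a, a < t v → ¬ P a v).congr fun v => by push Not; rfl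

/-! ### Induction, least numbers, comprehension -/

theorem Sig.induction {P : M.Num → Prop} (hP : Sig (fun v => P (v 0)))
    (h0 : P 0) (h1 : ∀ n, P n → P (n + 1)) (n : M.Num) : P n :=
  hM.isModel.sigma01_induction P hP.isSigma01 h0 h1 n

theorem setOf_mem_sets {P : M.Num → Prop} (hP : Rec (fun v => P (v 0))) :
    {n | P n} ∈ M.sets := by
  obtain ⟨Q, hQ, h⟩ := hP.nsig.out
  have h1 := D0.isPi01 (P := fun a n => ¬ Q a (fun _ => n))
    (hQ.ren (fun i => match i with | 0 => 0 | _ + 1 => 1)).not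
  obtain ⟨X, hX, hX'⟩ := hM.isModel.delta01_comprehension P hP.sig.isSigma01 (by
    convert h1 using 2 with n
    rw [← not_exists, ← h fun _ => n, not_not])
  rwa [show {n | P n} = X from Set.ext fun n => (hX' n).symm]

/-- The induction is on "no `m < n` satisfies `P`", which is `Σ⁰₁` because the complement of `P` is.
-/
theorem Rec.exists_least {P : M.Num → Prop} (hP : Rec (fun v => P (v 0))) (h : ∃ n, P n) :
    ∃ n, P n ∧ ∀ m, m < n → ¬ P m := by
  by_contra! hc
  have : ∀ n, ∀ m, m < n → ¬ P m := by
    refine Sig.induction ?_ (fun m hm => (hM.isModel.not_lt_zero _ hm).elim) fun n h m hm hP => ?_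
    · have : Sig (fun v : ℕ → M.Num => ¬ P (v 0)) := hP.nsig
      exact Sig.ball (P := fun a _ => ¬ P a)
    · obtain ⟨k, hk, hk'⟩ := hc m hP
      exact h k (hk.trans_le (lt_add_one_iff.1 hm)) hk'
  obtain ⟨n, hn⟩ := h
  exact this _ n (lt_add_one _) hn

/-- A `Δ⁰₁` relation which is total has a choice function with a `Σ⁰₁` graph. -/
theorem Rec.exists_fun {P : M.Num → M.Num → Prop} (hP : Rec (fun v => P (v 0) (v 1)))
    (h : ∀ x, ∃ y, P x y) : ∃ F : M.Num → M.Num, RecFun (fun v => F (v 0)) ∧ ∀ x, P x (F x) := by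
  have h' : ∀ x, ∃ y, P x y ∧ ∀ z, z < y → ¬ P x z := fun x =>
    Rec.exists_least (hP.comp2 (.const x) (.var 0)) (h x)
  choose F hF hF' using h'
  refine ⟨F, ⟨?_⟩, hF⟩
  have h1 : Rec (fun v : ℕ → M.Num => P (v 1) (v 0)) := hP.comp2 (.var 1) (.var 0)
  have h2 : Rec (fun v : ℕ → M.Num => P (v 2) (v 0)) := hP.comp2 (.var 2) (.var 0)
  have h3 : Rec (fun v : ℕ → M.Num => ∀ z, z < v 0 → ¬ P (v 1) z) :=
    Rec.ball (P := fun z v => ¬ P (v 1) z)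
  refine (inferInstance : Sig fun v : ℕ → M.Num => P (v 1) (v 0) ∧ ∀ z, z < v 0 → ¬ P (v 1) z).congr
    fun v => ⟨fun h => ?_, fun ⟨h1, h2⟩ => ?_⟩
  · rw [h]
    exact ⟨hF _, hF' _⟩
  · rcases lt_trichotomy (v 0) (F (v 1)) with h | h | h
    · exact (hF' _ _ h h1).elim
    · exact h
    · exact (h2 _ h (hF _)).elim

end

end L2Structure

namespace L2Structure

variable {M : L2Structure.{u}} [hM : Model M]

/-! ### Coding of finite sets -/

theorem not_lt_zero' (a : M.Num) : ¬ a < 0 := hM.isModel.not_lt_zero a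

theorem eq_zero_or_eq_add_one (n : M.Num) : n = 0 ∨ ∃ k, n = k + 1 := Num.eq_zero_or_succ n

theorem exists_eq_add_one {n : M.Num} (h : 0 < n) : ∃ k, n = k + 1 :=
  (eq_zero_or_eq_add_one n).resolve_left h.ne'

theorem add_one_pos (n : M.Num) : 0 < n + 1 := lt_add_one_iff.2 zero_le

theorem le_mul_self (a : M.Num) : a ≤ a * a := by
  rcases eq_zero_or_eq_add_one a with rfl | ⟨k, rfl⟩
  · simp
  · exact le_iff_exists_eq_add.2 ⟨k * k + k, by ring⟩

theorem left_le_pair (a b : M.Num) : a ≤ pair a b := le_add_self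

theorem right_le_pair (a b : M.Num) : b ≤ pair a b :=
  le_add_self.trans ((le_mul_self (a + b)).trans le_self_add)

/-- Since `a ≤ a + b`, the value lies strictly below the next square `(a + b + 1)²`; so pairs are
ordered by their sum first, which gives injectivity. -/
theorem pair_lt_pair_of_add_lt {a b a' b' : M.Num} (h : a + b < a' + b') :
    pair a b < pair a' b' := by
  obtain ⟨k, hk⟩ := lt_iff_exists_add.1 h
  unfold pair
  rw [hk]
  exact lt_iff_exists_add.2 ⟨a + 2 * b + 2 * (a + b) * k + k * k + 2 * k + a', by ring⟩

theorem pair_inj {a b a' b' : M.Num} : pair a b = pair a' b' ↔ a = a' ∧ b = b' := by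
  refine ⟨fun h => ?_, fun ⟨h, h'⟩ => by rw [h, h']⟩
  have hs : a + b = a' + b' := by
    rcases lt_trichotomy (a + b) (a' + b') with h' | h' | h'
    · exact ((pair_lt_pair_of_add_lt h').ne h).elim
    · exact h'
    · exact ((pair_lt_pair_of_add_lt h').ne' h).elim
  have ha : a = a' := by
    unfold pair at h
    rw [hs] at h
    exact add_left_cancel h
  subst ha
  exact ⟨rfl, add_left_cancel hs⟩

theorem pair_lt_pair {a b k l : M.Num} (ha : a < k) (hb : b < l) : pair a b < pair k l :=
  pair_lt_pair_of_add_lt (add_lt_add ha hb)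

theorem inCode_pair {i k m n : M.Num} :
    InCode i (pair k (pair m n)) ↔ i < k ∧ (m * (i + 1) + 1) ∣ n := by
  constructor
  · rintro ⟨k', m', n', h, hi, q, hq⟩
    obtain ⟨h1, h⟩ := pair_inj.1 h
    obtain ⟨rfl, rfl⟩ := pair_inj.1 h
    exact ⟨h1 ▸ hi, q, hq⟩
  · rintro ⟨hi, q, hq⟩
    exact ⟨k, m, n, rfl, hi, q, hq⟩

theorem InCode.lt {i c : M.Num} (h : InCode i c) : i < c := by
  obtain ⟨k, m, n, rfl, hi, -⟩ := h
  exact hi.trans_le (left_le_pair _ _)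

theorem not_inCode_zero (i : M.Num) : ¬ InCode i 0 := fun h => not_lt_zero' _ h.lt

/-- All components, and the quotient `q`, are bounded by the code, so membership is `Δ⁰₁`. -/
theorem inCode_iff_bounded {i c : M.Num} : InCode i c ↔ ∃ k, k < c + 1 ∧ ∃ m, m < c + 1 ∧
    ∃ n, n < c + 1 ∧ c = pair k (pair m n) ∧ i < k ∧
      ∃ q, q < n + 1 ∧ n = (m * (i + 1) + 1) * q := by
  constructor
  · rintro ⟨k, m, n, rfl, hi, q, hq⟩
    refine ⟨k, lt_add_one_iff.2 (left_le_pair _ _), m,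
      lt_add_one_iff.2 ((left_le_pair _ _).trans (right_le_pair _ _)), n,
      lt_add_one_iff.2 ((right_le_pair _ _).trans (right_le_pair _ _)), rfl, hi, q, ?_, hq⟩
    rw [lt_add_one_iff, hq, add_mul, one_mul]
    exact le_add_self
  · rintro ⟨k, -, m, -, n, -, h, hi, q, -, hq⟩
    exact ⟨k, m, n, h, hi, q, hq⟩

instance Rec.inCode {s t : (ℕ → M.Num) → M.Num} [hs : RecFun s] [ht : RecFun t] :
    Rec (fun v => InCode (s v) (t v)) := by
  refine .comp2 (P := InCode) ?_ hs ht
  simp only [inCode_iff_bounded]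
  infer_instance

instance Rec.isFinCode {s : (ℕ → M.Num) → M.Num} [hs : RecFun s] :
    Rec (fun v => IsFinCode (s v)) := by
  refine .comp1 (P := IsFinCode) ?_ hs
  have : ∀ c : M.Num, IsFinCode c ↔ ∀ c', c' < c → ¬ ∀ i, i < c + c' →
      (InCode i c' ↔ InCode i c) := fun c =>
    forall₂_congr fun c' _ => not_congr ⟨fun h i _ => h i, fun h i => ⟨fun hi =>
      (h i (hi.lt.trans_le le_add_self)).1 hi, fun hi => (h i (hi.lt.trans_le le_self_add)).2 hi⟩⟩
  simp only [this]
  infer_instance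

instance Rec.seqVal {r s t : (ℕ → M.Num) → M.Num} [hr : RecFun r] [hs : RecFun s]
    [ht : RecFun t] : Rec (fun v => SeqVal (r v) (s v) (t v)) := by
  unfold SeqVal
  infer_instance

theorem exists_isFinCode (c : M.Num) :
    ∃ c', c' ≤ c ∧ IsFinCode c' ∧ ∀ i, InCode i c' ↔ InCode i c := by
  obtain ⟨c', h, h'⟩ := Rec.exists_least
    (P := fun c' => ∀ i, i < c + c' → (InCode i c' ↔ InCode i c)) inferInstance ⟨c, by simp⟩
  have hc' : ∀ i, InCode i c' ↔ InCode i c := fun i => ⟨fun hi =>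
      (h i (hi.lt.trans_le le_add_self)).1 hi, fun hi => (h i (hi.lt.trans_le le_self_add)).2 hi⟩
  refine ⟨c', not_lt.1 fun hlt => h' c hlt fun _ _ => Iff.rfl, fun d hd hd' => h' d hd fun i _ =>
    (hd' i).trans (hc' i), hc'⟩

theorem IsFinCode.ext {c d : M.Num} (hc : IsFinCode c) (hd : IsFinCode d)
    (h : ∀ i, InCode i c ↔ InCode i d) : c = d := by
  rcases lt_trichotomy c d with h' | h' | h'
  · exact (hd c h' h).elim
  · exact h'
  · exact (hc d h' fun i => (h i).symm).elim

theorem isFinCode_zero : IsFinCode (0 : M.Num) := fun _ h => (not_lt_zero' _ h).elim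

/-! ### Coprimality without subtraction, and Gödel's coding -/

/-- `b` is invertible modulo `a`. -/
def InvMod (a b : M.Num) : Prop := ∃ v w, b * v = a * w + 1

theorem InvMod.mul {a b c : M.Num} (hb : InvMod a b) (hc : InvMod a c) : InvMod a (b * c) := by
  obtain ⟨v, w, h⟩ := hb
  obtain ⟨v', w', h'⟩ := hc
  refine ⟨v * v', a * w * w' + w + w', ?_⟩
  calc b * c * (v * v') = (b * v) * (c * v') := by ring
    _ = _ := by rw [h, h']; ring

theorem InvMod.symm {a b : M.Num} (ha : 0 < a) (h : InvMod a b) : InvMod b a := by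
  obtain ⟨v, w, h⟩ := h
  obtain ⟨a, rfl⟩ := exists_eq_add_one ha
  rcases eq_zero_or_eq_add_one b with rfl | ⟨b, rfl⟩
  · rw [zero_mul] at h
    exact (add_one_ne_zero _ h.symm).elim
  -- From `b v = a w + 1`, the inverse of `a` modulo `b` is `-w`. With both numbers now written as
  -- successors, `w * b` represents `-w` modulo `b + 1`; one more modulus is added so that the
  -- quotient needs no subtraction.
  · refine ⟨w * b + (b + 1), v * b + a, ?_⟩
    calc (a + 1) * (w * b + (b + 1)) = ((a + 1) * w + 1) * b + (b + 1) * a + 1 := by ring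
      _ = _ := by rw [← h]; ring

theorem dvd_of_dvd_add {a b c : M.Num} (ha : 0 < a) (h : a ∣ b + c) (hb : a ∣ b) : a ∣ c := by
  obtain ⟨q, hq⟩ := h
  obtain ⟨r, rfl⟩ := hb
  have : r ≤ q := by
    by_contra! hlt
    have := mul_lt_mul_of_pos a q r ha hlt
    rw [← hq] at this
    exact not_lt.2 le_self_add this
  obtain ⟨k, rfl⟩ := le_iff_exists_eq_add.1 this
  rw [mul_add] at hq
  exact ⟨k, add_left_cancel hq⟩

theorem InvMod.dvd {a b x : M.Num} (ha : 0 < a) (h : InvMod a b) (hx : a ∣ b * x) : a ∣ x := by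
  obtain ⟨v, w, h⟩ := h
  refine dvd_of_dvd_add ha (b := a * w * x) ?_ ⟨w * x, by ring⟩
  rw [← one_mul x, ← mul_assoc, mul_one, ← add_mul, ← h, mul_right_comm]
  exact hx.mul_right v

/-- Modulo `m s + 1` one has `m s ≡ -1`, and the other number is congruent to `m d`. With `m = d q`,
the product `m d · s q s` is `(m s)² ≡ 1`. -/
theorem invMod_beta {m d s : M.Num} (hm : 0 < m) (hs : 0 < s) (hd : d ∣ m) :
    InvMod (m * s + 1) (m * (s + d) + 1) := by
  obtain ⟨q, hq⟩ := hd
  have hpos : 0 < m * s := by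
    rw [← mul_zero m]
    exact mul_lt_mul_of_pos _ _ _ hm hs
  obtain ⟨e, he⟩ := exists_eq_add_one hpos
  refine ⟨s * q * s, s * q * s + e, ?_⟩
  calc (m * (s + d) + 1) * (s * q * s) = (m * s + 1) * (s * q * s) + (m * s) * ((d * q) * s) := by
        ring
    _ = _ := by rw [← hq, he]; ring

/-- This replaces a factorial or a product: the induction only asserts that some positive common
multiple exists, which is `Σ⁰₁`. -/
theorem exists_common_multiple (t : M.Num → M.Num) (ht : IsTm fun v => t (v 0))
    (hpos : ∀ j, 0 < t j) (k : M.Num) : ∃ m, 0 < m ∧ ∀ j, j < k → t j ∣ m := by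
  have : ∀ (s : (ℕ → M.Num) → M.Num) [RecFun s], RecFun (fun v => t (s v)) := fun s hs =>
    ht.recFun.comp1 hs
  refine Sig.induction (P := fun k : M.Num => ∃ m, 0 < m ∧ ∀ j, j < k → ∃ q, m = t j * q)
    ?_ ⟨1, zero_lt_one, fun j hj => (not_lt_zero' _ hj).elim⟩ ?_ k
  · infer_instance
  rintro n ⟨m, hm, h⟩
  refine ⟨m * t n, ?_, fun j hj => ?_⟩
  · rw [← mul_zero m]
    exact mul_lt_mul_of_pos _ _ _ hm (hpos n)
  · rcases (lt_add_one_iff.1 hj).lt_or_eq with hj | rfl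
    · exact Dvd.dvd.mul_right (h j hj) _
    · exact ⟨m, mul_comm _ _⟩

/-- `b` codes the interval below `k`, in such a way that all subsets can be coded below `b`. -/
def IsCodeBound (k b : M.Num) : Prop :=
  ∃ m, m < b + 1 ∧ ∃ n, n < b + 1 ∧ b = pair k (pair m n) ∧ 0 < m ∧ 0 < n ∧
    (∀ j, j < k → ∃ q, q < m + 1 ∧ m = (j + 1) * q) ∧
    ∀ j, j < k → ∃ q, q < n + 1 ∧ n = (m * (j + 1) + 1) * q

instance Rec.isCodeBound {s t : (ℕ → M.Num) → M.Num} [hs : RecFun s] [ht : RecFun t] :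
    Rec (fun v => IsCodeBound (s v) (t v)) := by
  refine .comp2 (P := IsCodeBound) ?_ hs ht
  unfold IsCodeBound
  infer_instance

theorem le_mul_of_pos {a b : M.Num} (ha : 0 < a) : b ≤ a * b := by
  obtain ⟨a, rfl⟩ := exists_eq_add_one ha
  rw [add_mul, one_mul]
  exact le_add_self

theorem exists_isCodeBound (k : M.Num) : ∃ b, IsCodeBound k b := by
  obtain ⟨m, hm, h⟩ := exists_common_multiple (fun j : M.Num => j + 1) (.add (.var 0) (.const 1))
    (fun j => add_one_pos j) k
  obtain ⟨n, hn, h'⟩ := exists_common_multiple (fun j : M.Num => m * (j + 1) + 1)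
    (.add (.mul (.const m) (.add (.var 0) (.const 1))) (.const 1)) (fun j => add_one_pos _) k
  refine ⟨_, m, lt_add_one_iff.2 ((left_le_pair _ _).trans (right_le_pair _ _)), n,
    lt_add_one_iff.2 ((right_le_pair _ _).trans (right_le_pair _ _)), rfl, hm, hn, ?_, ?_⟩
  · intro j hj
    obtain ⟨q, hq⟩ := h j hj
    exact ⟨q, lt_add_one_iff.2 (hq ▸ le_mul_of_pos (add_one_pos _)), hq⟩
  · intro j hj
    obtain ⟨q, hq⟩ := h' j hj
    exact ⟨q, lt_add_one_iff.2 (hq ▸ le_mul_of_pos (add_one_pos _)), hq⟩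

/-- The moduli `m(i+1)+1`, `i < k`, are pairwise coprime because every difference of indices divides
`m`. Those with `i ∈ X` are multiplied up one at a time. Keeping the product a divisor of `N` keeps
the code below `b`. -/
theorem IsCodeBound.exists_code {k b : M.Num} (hb : IsCodeBound k b) {X : Set M.Num}
    (hX : X ∈ M.sets) :
    ∃ c, c ≤ b ∧ IsFinCode c ∧ ∀ i, InCode i c ↔ i < k ∧ i ∈ X := by
  obtain ⟨m, -, N, -, rfl, hm, hN, hmk, hNk⟩ := hb
  have hpos : ∀ i, 0 < m * (i + 1) + 1 := fun i => add_one_pos _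
  have hcop : ∀ i j, i < k → j < k → i ≠ j → InvMod (m * (i + 1) + 1) (m * (j + 1) + 1) := by
    have : ∀ i j, i < j → j < k → InvMod (m * (i + 1) + 1) (m * (j + 1) + 1) := by
      intro i j hij hj
      obtain ⟨d, rfl⟩ := lt_iff_exists_add.1 hij
      obtain ⟨q, -, hq⟩ := hmk d ((lt_add_one_iff.2 le_add_self).trans hj)
      have := invMod_beta hm (add_one_pos i) ⟨q, hq⟩
      rwa [show i + 1 + (d + 1) = i + d + 1 + 1 by ring] at this
    intro i j hi hj hij
    rcases hij.lt_or_gt with h | h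
    · exact this i j h hj
    · exact (this j i h hi).symm (hpos j)
  have key : ∃ n, (∃ q, N = n * q) ∧ ∀ i, i < k →
      ((i < k ∧ i ∈ X) → ∃ q, n = (m * (i + 1) + 1) * q) ∧
      (¬ (i < k ∧ i ∈ X) → ∃ v w, n * v = (m * (i + 1) + 1) * w + 1) := by
    have hXr : ∀ (s : (ℕ → M.Num) → M.Num) [RecFun s], Rec (fun v => s v ∈ X) :=
      fun s hs => Rec.mem hX hs
    refine Sig.induction (P := fun t : M.Num => t < k + 1 → ∃ n, (∃ q, N = n * q) ∧ ∀ i, i < k →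
      ((i < t ∧ i ∈ X) → ∃ q, n = (m * (i + 1) + 1) * q) ∧
      (¬ (i < t ∧ i ∈ X) → ∃ v w, n * v = (m * (i + 1) + 1) * w + 1)) inferInstance ?_ ?_ k
      (lt_add_one _)
    · intro _
      refine ⟨1, ⟨N, (one_mul _).symm⟩, fun i _ => ⟨fun h => (not_lt_zero' _ h.1).elim, fun _ =>
        ⟨1, 0, by ring⟩⟩⟩
    · intro t ih ht
      have htk : t < k := lt_of_add_lt_add_right ht
      obtain ⟨n, ⟨q, hq⟩, hn⟩ := ih (htk.trans (lt_add_one _))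
      by_cases htX : t ∈ X
      · have hinv : InvMod (m * (t + 1) + 1) n := (hn t htk).2 fun h => lt_irrefl _ h.1
        obtain ⟨r, -, hr⟩ := hNk t htk
        -- The modulus of `t` divides `N = n q` and `n` is invertible modulo it, so it divides `q`;
        -- hence `n` times the modulus still divides `N`.
        obtain ⟨u, rfl⟩ := hinv.dvd (hpos t) (x := q) ⟨r, hq ▸ hr⟩
        refine ⟨n * (m * (t + 1) + 1), ⟨u, by rw [hq]; ring⟩, fun i hi => ⟨fun h => ?_, fun h => ?_⟩⟩
        · rcases (lt_add_one_iff.1 h.1).lt_or_eq with hit | rfl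
          · exact Dvd.dvd.mul_right ((hn i hi).1 ⟨hit, h.2⟩) _
          · exact ⟨n, mul_comm _ _⟩
        · have hit : i ≠ t := fun hit => h ⟨hit ▸ lt_add_one _, hit ▸ htX⟩
          exact InvMod.mul ((hn i hi).2 fun h' => h ⟨h'.1.trans (lt_add_one _), h'.2⟩)
            (hcop i t hi htk hit)
      · refine ⟨n, ⟨q, hq⟩, fun i hi => ?_⟩
        have : (i < t + 1 ∧ i ∈ X) ↔ (i < t ∧ i ∈ X) := by
          rw [lt_add_one_iff, le_iff_lt_or_eq]
          constructor
          · rintro ⟨h | rfl, h'⟩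
            exacts [⟨h, h'⟩, (htX h').elim]
          · exact fun h => ⟨.inl h.1, h.2⟩
        rw [this]
        exact hn i hi
  obtain ⟨n, ⟨q, hq⟩, hn⟩ := key
  obtain ⟨c, hc, hc', hc''⟩ := exists_isFinCode (pair k (pair m n))
  refine ⟨c, hc.trans ?_, hc', fun i => ?_⟩
  · have hnN : n ≤ N := by
      rcases eq_zero_or_eq_add_one q with rfl | ⟨q, rfl⟩
      · rw [mul_zero] at hq
        exact (hN.ne' hq).elim
      · rw [hq, mul_add, mul_one]
        exact le_add_self
    unfold pair
    gcongr
  · rw [hc'', inCode_pair]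
    refine and_congr_right fun hi => ⟨fun h => ?_, fun h => (hn i hi).1 ⟨hi, h⟩⟩
    by_contra hiX
    have hinv : InvMod (m * (i + 1) + 1) n := (hn i hi).2 fun h => hiX h.2
    -- If the modulus of some `i ∉ X` divided `n`, to which it is coprime, it would divide `1`; but
    -- it exceeds `1`, as `m` is positive.
    have h1 := hinv.dvd (hpos i) (x := 1) (by rwa [mul_one])
    obtain ⟨r, hr⟩ := h1
    rcases eq_zero_or_eq_add_one r with rfl | ⟨r, rfl⟩
    · rw [mul_zero] at hr
      exact one_ne_zero hr
    · obtain ⟨m, rfl⟩ := exists_eq_add_one hm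
      have : (1 : M.Num) + 0 = 1 + ((m + 1) * (i + 1) * (r + 1) + r) := by
        rw [add_zero]
        nth_rewrite 1 [hr]
        ring
      have h2 := add_left_cancel this
      have h3 : (m + 1) * (i + 1) * (r + 1) + r =
        (m * i * r + m * i + m * r + m + i * r + i + r + r) + 1 := by ring
      rw [h3] at h2
      exact add_one_ne_zero _ h2.symm

/-- Bounded `Δ⁰₁` sets have codes. -/
theorem exists_code {P : M.Num → Prop} (hP : Rec (fun v => P (v 0))) (k : M.Num)
    (hk : ∀ i, P i → i < k) : ∃ c, IsFinCode c ∧ ∀ i, InCode i c ↔ P i := by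
  obtain ⟨b, hb⟩ := exists_isCodeBound k
  obtain ⟨c, -, hc, h⟩ := hb.exists_code (setOf_mem_sets hP)
  exact ⟨c, hc, fun i => (h i).trans ⟨And.right, fun h => ⟨hk i h, h⟩⟩⟩

/-- The bounded set coded by `σ` has a least code at most `b`, and that code is `σ`. This makes
quantifiers over Boolean vectors bounded. -/
theorem IsCodeBound.le {k b σ : M.Num} (hb : IsCodeBound k b) (hσ : IsVector k σ) : σ ≤ b := by
  obtain ⟨c, hcb, hc, h⟩ := hb.exists_code (X := {i | InCode i σ}) (setOf_mem_sets inferInstance)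
  rwa [hσ.1.ext hc fun i => ((h i).trans ⟨And.right, fun h => ⟨hσ.2 i h, h⟩⟩).symm]

theorem exists_insert (c p : M.Num) :
    ∃ d, IsFinCode d ∧ ∀ i, InCode i d ↔ InCode i c ∨ i = p := by
  refine exists_code (P := fun i => InCode i c ∨ i = p) inferInstance (c + p + 1) ?_
  rintro i (h | rfl)
  · exact h.lt.trans_le (by rw [add_assoc]; exact le_self_add)
  · exact lt_add_one_iff.2 le_add_self

/-! ### Coding of finite sequences -/

theorem SeqVal.lt {s i v : M.Num} (h : SeqVal s i v) : v < s :=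
  (right_le_pair _ _).trans_lt (InCode.lt h)

theorem SeqVal.index_lt' {s i v : M.Num} (h : SeqVal s i v) : i < s :=
  (left_le_pair _ _).trans_lt (InCode.lt h)

omit hM in
theorem IsSeq.exists_val {n s i : M.Num} (hs : IsSeq n s) (hi : i < n) : ∃ v, SeqVal s i v :=
  (hs.2.2 i hi).exists

theorem IsSeq.index_lt {n s i v : M.Num} (hs : IsSeq n s) (h : SeqVal s i v) : i < n := by
  obtain ⟨j, w, hj, hp⟩ := hs.2.1 _ h
  rw [(pair_inj.1 hp).1]
  exact hj

theorem IsSeq.unique {n s i v w : M.Num} (hs : IsSeq n s) (h : SeqVal s i v)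
    (h' : SeqVal s i w) : v = w :=
  (hs.2.2 i (hs.index_lt h)).unique h h'

theorem isSeq_iff_bounded {n s : M.Num} : IsSeq n s ↔ IsFinCode s ∧
    (∀ p, p < s → InCode p s → ∃ i, i < n ∧ ∃ v, v < p + 1 ∧ p = pair i v) ∧
    (∀ i, i < n → ∃ v, v < s ∧ InCode (pair i v) s) ∧
    ∀ i, i < n → ∀ v, v < s → ∀ w, w < s → InCode (pair i v) s → InCode (pair i w) s → v = w := by
  constructor
  · intro hs
    refine ⟨hs.1, fun p _ hp => ?_, fun i hi => ?_, fun i _ v _ w _ hv hw => hs.unique hv hw⟩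
    · obtain ⟨i, v, hi, rfl⟩ := hs.2.1 p hp
      exact ⟨i, hi, v, lt_add_one_iff.2 (right_le_pair _ _), rfl⟩
    · obtain ⟨v, hv⟩ := hs.exists_val hi
      exact ⟨v, hv.lt, hv⟩
  · rintro ⟨h1, h2, h3, h4⟩
    refine ⟨h1, fun p hp => ?_, fun i hi => ?_⟩
    · obtain ⟨i, hi, v, -, h⟩ := h2 p hp.lt hp
      exact ⟨i, v, hi, h⟩
    · obtain ⟨v, -, hv⟩ := h3 i hi
      exact ⟨v, hv, fun w hw => h4 i hi w (SeqVal.lt hw) v (SeqVal.lt hv) hw hv⟩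

instance Rec.isSeq {s t : (ℕ → M.Num) → M.Num} [hs : RecFun s] [ht : RecFun t] :
    Rec (fun v => IsSeq (s v) (t v)) := by
  refine .comp2 (P := IsSeq) ?_ hs ht
  simp only [isSeq_iff_bounded]
  infer_instance

/-- The uniform bound `b` on the values makes the graph a bounded `Δ⁰₁` set, hence coded. -/
theorem exists_isSeq {P : M.Num → M.Num → Prop} (hP : Rec (fun v => P (v 0) (v 1)))
    (n b : M.Num) (h : ∀ i, i < n → ∃! v, P i v) (hb : ∀ i v, i < n → P i v → v < b) :
    ∃ s, IsSeq n s ∧ ∀ i v, SeqVal s i v ↔ i < n ∧ P i v := by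
  have hP' : Rec (fun v : ℕ → M.Num => P (v 1) (v 0)) := hP.comp2 (.var 1) (.var 0)
  have hr : Rec (fun v : ℕ → M.Num => ∃ i, i < n ∧ ∃ w, w < b ∧ v 0 = pair i w ∧ P i w) := by
    refine Rec.bex (P := fun i v => ∃ w, w < b ∧ v 0 = pair i w ∧ P i w) (hP := ?_)
    exact Rec.bex (P := fun w v => v 1 = pair (v 0) w ∧ P (v 0) w)
  obtain ⟨c, hc, hc'⟩ := exists_code (P := fun p => ∃ i, i < n ∧ ∃ w, w < b ∧ p = pair i w ∧ P i w)
    hr (pair n b) (by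
      rintro p ⟨i, hi, w, hw, rfl, -⟩
      exact pair_lt_pair hi hw)
  have hval : ∀ i v, SeqVal c i v ↔ i < n ∧ P i v := by
    intro i v
    refine (hc' _).trans ⟨?_, fun ⟨hi, hv⟩ => ⟨i, hi, v, hb i v hi hv, rfl, hv⟩⟩
    rintro ⟨j, hj, w, -, hp, hw⟩
    obtain ⟨rfl, rfl⟩ := pair_inj.1 hp
    exact ⟨hj, hw⟩
  refine ⟨c, ⟨hc, fun p hp => ?_, fun i hi => ?_⟩, hval⟩
  · obtain ⟨i, hi, w, -, hp, -⟩ := (hc' p).1 hp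
    exact ⟨i, w, hi, hp⟩
  · obtain ⟨v, hv, hv'⟩ := h i hi
    exact ⟨v, (hval i v).2 ⟨hi, hv⟩, fun w hw => hv' w ((hval i w).1 hw).2⟩

end L2Structure

namespace L2Structure

variable {M : L2Structure.{u}} [hM : Model M]

/-! ### Oracle computations -/

theorem step_iff_bounded {X : Set M.Num} {e p s p' s' : M.Num} : Step X e p s p' s' ↔
    ∃ r v v', SeqVal s r v ∧ SeqVal s' r v' ∧
    (∀ i, i < s + s' → ¬ i = r → ∀ w, w < s + s' → (SeqVal s i w ↔ SeqVal s' i w)) ∧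
    ((SeqVal e p (pair 0 r) ∧ v' = v + 1 ∧ p' = p + 1) ∨
      (∃ q, SeqVal e p (pair 1 (pair r q)) ∧
        ((v = 0 ∧ v' = 0 ∧ p' = q) ∨ (v = v' + 1 ∧ p' = p + 1))) ∨
      (SeqVal e p (pair (1 + 1) r) ∧ ((v ∈ X ∧ v' = 1) ∨ (¬ v ∈ X ∧ v' = 0)) ∧ p' = p + 1)) := by
  refine exists_congr fun r => exists_congr fun v => exists_congr fun v' => and_congr_right fun _ =>
    and_congr_right fun _ => and_congr_left fun _ =>
    ⟨fun h i _ hi w _ => h i hi w, fun h i hi w => ⟨fun hw => ?_, fun hw => ?_⟩⟩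
  · exact (h i (hw.index_lt'.trans_le le_self_add) hi w (hw.lt.trans_le le_self_add)).1 hw
  · exact (h i (hw.index_lt'.trans_le le_add_self) hi w (hw.lt.trans_le le_add_self)).2 hw

set_option synthInstance.maxSize 2000 in
set_option synthInstance.maxHeartbeats 200000 in
-- Once the configurations are bounded by the history `h` and registers by their codes, only
-- existential quantifiers over numbers remain unbounded.
theorem sig_computes {X : Set M.Num} (hX : X ∈ M.sets) :
    Sig (fun v => Computes X (v 0) (v 1) (v 2)) := by
  have : ∀ (s : (ℕ → M.Num) → M.Num) [RecFun s], Rec (fun v => s v ∈ X) :=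
    fun s hs => Rec.mem hX hs
  have key : ∀ e x y : M.Num, Computes X e x y ↔ ∃ ℓ L T h, IsSeq ℓ e ∧ IsSeq (T + 1) h ∧
    (∀ t, t < T + 1 → ∀ c, c < h → SeqVal h t c → ∃ p s, c = pair p s ∧ IsSeq L s) ∧
    (∃ s, SeqVal h 0 (pair 0 s) ∧ SeqVal s 0 x ∧ ∀ i, i < L → ¬ i = 0 → SeqVal s i 0) ∧
    (∀ t, t < T → ∃ p s p' s',
      SeqVal h t (pair p s) ∧ SeqVal h (t + 1) (pair p' s') ∧ Step X e p s p' s') ∧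
    ∃ p s, SeqVal h T (pair p s) ∧ ¬ p < ℓ ∧ SeqVal s 0 y := by
    intro e x y
    refine exists_congr fun ℓ => exists_congr fun L => exists_congr fun T => exists_congr fun h =>
      and_congr_right fun _ => and_congr_right fun _ => and_congr_left fun _ =>
      ⟨fun h t ht c _ => h t c ht, fun h t c ht hc => h t ht c hc.lt hc⟩
  simp only [key, step_iff_bounded]
  infer_instance

/-- The finite partial functions `s` and `t` have the same value wherever both are defined. -/
def Agree (s t : M.Num) : Prop := ∀ i v w, SeqVal s i v → SeqVal t i w → v = w

/-- Two computations may be recorded with different numbers of registers, so states are compared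
only on their common registers. An instruction names its register, and both states hold a value
there. -/
theorem Agree.step {X : Set M.Num} {e p s p₁ s₁ t p₂ t₁ ℓ L L' : M.Num} (he : IsSeq ℓ e)
    (hs₁ : IsSeq L s₁) (ht₁ : IsSeq L' t₁) (h : Agree s t) (h₁ : Step X e p s p₁ s₁)
    (h₂ : Step X e p t p₂ t₁) : p₁ = p₂ ∧ Agree s₁ t₁ := by
  obtain ⟨r, v, v', hv, hv', ho, hc⟩ := h₁
  obtain ⟨q, w, w', hw, hw', ho', hc'⟩ := h₂
  have h01 : (0 : M.Num) ≠ 1 := zero_ne_one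
  have h02 : (0 : M.Num) ≠ 1 + 1 := (add_one_ne_zero 1).symm
  have h12 : (1 : M.Num) ≠ 1 + 1 := fun h => add_one_ne_zero (0 : M.Num) (by
    rw [zero_add]
    nth_rewrite 1 [← add_zero (1 : M.Num)] at h
    exact (add_left_cancel h).symm)
  have hrq : r = q ∧ (v = w → p₁ = p₂ ∧ v' = w') := by
    rcases hc with ⟨hi, rfl, rfl⟩ | ⟨j, hi, hc⟩ | ⟨hi, hc, rfl⟩ <;>
    rcases hc' with ⟨hi', rfl, rfl⟩ | ⟨j', hi', hc'⟩ | ⟨hi', hc', rfl⟩ <;>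
    have hii := pair_inj.1 (he.unique hi hi')
    · exact ⟨hii.2, fun h => ⟨rfl, by rw [h]⟩⟩
    · exact (h01 hii.1).elim
    · exact (h02 hii.1).elim
    · exact (h01 hii.1.symm).elim
    · obtain ⟨rfl, rfl⟩ := pair_inj.1 hii.2
      refine ⟨rfl, ?_⟩
      rintro rfl
      rcases hc with ⟨rfl, rfl, rfl⟩ | ⟨rfl, rfl⟩ <;> rcases hc' with ⟨h0, rfl, rfl⟩ | ⟨h0, rfl⟩
      · exact ⟨rfl, rfl⟩
      · exact (add_one_ne_zero _ h0.symm).elim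
      · exact (add_one_ne_zero _ h0).elim
      · exact ⟨rfl, add_right_cancel h0⟩
    · exact (h12 hii.1).elim
    · exact (h02 hii.1.symm).elim
    · exact (h12 hii.1.symm).elim
    · refine ⟨hii.2, ?_⟩
      rintro rfl
      rcases hc with ⟨hX, rfl⟩ | ⟨hX, rfl⟩ <;> rcases hc' with ⟨hX', rfl⟩ | ⟨hX', rfl⟩
      · exact ⟨rfl, rfl⟩
      · exact (hX' hX).elim
      · exact (hX hX').elim
      · exact ⟨rfl, rfl⟩
  obtain ⟨rfl, hpv⟩ := hrq
  obtain ⟨hp, hvw⟩ := hpv (h r v w hv hw)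
  refine ⟨hp, fun i a b ha hb => ?_⟩
  by_cases hir : i = r
  · subst hir
    rw [hs₁.unique ha hv', ht₁.unique hb hw', hvw]
  · exact h i a b ((ho i hir a).2 ha) ((ho' i hir b).2 hb)

theorem IsSeq.length_le {n m s : M.Num} (hn : IsSeq n s) (hm : IsSeq m s) : n ≤ m := by
  by_contra! h
  obtain ⟨v, hv⟩ := hn.exists_val h
  exact lt_irrefl _ (hm.index_lt hv)

/-- The two histories run in lockstep. If one halted earlier, its program counter would be outside
the program while the other history still makes a step from the same counter. -/
theorem Computes.unique {X : Set M.Num} {e x y y' : M.Num} (h : Computes X e x y)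
    (h' : Computes X e x y') : y = y' := by
  obtain ⟨ℓ, L, T, h, he, hh, hc, ⟨s₀, hs₀, hx, hs₀'⟩, hstep, p, s, hT, hp, hy⟩ := h
  obtain ⟨ℓ', L', T', h', he', hh', hc', ⟨t₀, ht₀, hx', ht₀'⟩, hstep', p', s', hT', hp', hy'⟩ := h'
  obtain rfl : ℓ = ℓ' := le_antisymm (he.length_le he') (he'.length_le he)
  have hseq : ∀ t p s, SeqVal h t (pair p s) → IsSeq L s := fun t p s hs => by
    obtain ⟨_, _, h1, h2⟩ := hc t _ (hh.index_lt hs) hs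
    rwa [(pair_inj.1 h1).2]
  have hseq' : ∀ t p s, SeqVal h' t (pair p s) → IsSeq L' s := fun t p s hs => by
    obtain ⟨_, _, h1, h2⟩ := hc' t _ (hh'.index_lt hs) hs
    rwa [(pair_inj.1 h1).2]
  -- Agreement is spelled out with bounded quantifiers, to keep the induction formula `Σ⁰₁`.
  have key : ∀ t, t < T + 1 → t < T' + 1 → ∃ p s s', SeqVal h t (pair p s) ∧
      SeqVal h' t (pair p s') ∧ ∀ i, i < s → ∀ v, v < s → ∀ w, w < s' → SeqVal s i v →
      SeqVal s' i w → v = w := by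
    refine Sig.induction (by infer_instance) ?_ ?_
    · intro _ _
      refine ⟨0, s₀, t₀, hs₀, ht₀, fun i _ v _ w _ hv hw => ?_⟩
      by_cases hi : i = 0
      · subst hi
        rw [(hseq _ _ _ hs₀).unique hv hx, (hseq' _ _ _ ht₀).unique hw hx']
      · rw [(hseq _ _ _ hs₀).unique hv (hs₀' i ((hseq _ _ _ hs₀).index_lt hv) hi),
          (hseq' _ _ _ ht₀).unique hw (ht₀' i ((hseq' _ _ _ ht₀).index_lt hw) hi)]
    · intro t ih ht ht'
      have htT := lt_of_add_lt_add_right ht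
      have htT' := lt_of_add_lt_add_right ht'
      obtain ⟨p, s, s', hs, hs', hag⟩ := ih (htT.trans (lt_add_one _)) (htT'.trans (lt_add_one _))
      obtain ⟨q, u, q₁, u₁, hu, hu₁, hst⟩ := hstep t htT
      obtain ⟨q', u', q₁', u₁', hu', hu₁', hst'⟩ := hstep' t htT'
      obtain ⟨rfl, rfl⟩ := pair_inj.1 (hh.unique hs hu)
      obtain ⟨rfl, rfl⟩ := pair_inj.1 (hh'.unique hs' hu')
      obtain ⟨rfl, hag'⟩ := Agree.step he (hseq _ _ _ hu₁) (hseq' _ _ _ hu₁')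
        (fun i v w hv hw => hag i hv.index_lt' v hv.lt w hw.lt hv hw) hst hst'
      exact ⟨q₁, u₁, u₁', hu₁, hu₁', fun i _ v _ w _ hv hw => hag' i v w hv hw⟩
  have hprog : ∀ {p s p' s'}, Step X e p s p' s' → p < ℓ := by
    rintro p s p' s' ⟨r, v, v', -, -, -, hc⟩
    rcases hc with ⟨hi, -⟩ | ⟨j, hi, -⟩ | ⟨hi, -⟩ <;> exact he.index_lt hi
  rcases lt_trichotomy T T' with hTT | rfl | hTT
  · obtain ⟨q, u, u', hu, hu', -⟩ := key T (lt_add_one _) (hTT.trans (lt_add_one _))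
    obtain ⟨q₁, u₁, q₂, u₂, hu₁, -, hst⟩ := hstep' T hTT
    rw [(pair_inj.1 (hh.unique hT hu)).1, (pair_inj.1 (hh'.unique hu' hu₁)).1] at hp
    exact (hp (hprog hst)).elim
  · obtain ⟨q, u, u', hu, hu', hag⟩ := key T (lt_add_one _) (lt_add_one _)
    rw [(pair_inj.1 (hh.unique hT hu)).2] at hy
    rw [(pair_inj.1 (hh'.unique hT' hu')).2] at hy'
    exact hag 0 hy.index_lt' y hy.lt y' hy'.lt hy hy'
  · obtain ⟨q, u, u', hu, hu', -⟩ := key T' (hTT.trans (lt_add_one _)) (lt_add_one _)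
    obtain ⟨q₁, u₁, q₂, u₂, hu₁, -, hst⟩ := hstep T' hTT
    rw [(pair_inj.1 (hh'.unique hT' hu')).1, (pair_inj.1 (hh.unique hu hu₁)).1] at hp'
    exact (hp' (hprog hst)).elim

end L2Structure

namespace L2Structure

variable {M : L2Structure.{u}} [hM : Model M]

/-! ### Parity -/

/-- The finite set `P` lists those `j ≤ n` for which the number of `i < j` in `S` is odd. -/
def IsParity (P : M.Num) (S : M.Num → Prop) (n : M.Num) : Prop :=
  ¬ InCode 0 P ∧ ∀ i, i < n → (InCode (i + 1) P ↔ ¬ (InCode i P ↔ S i))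

/-- The number of `i < n` in `S` is odd. -/
def OddBelow (S : M.Num → Prop) (n : M.Num) : Prop := ∃ P, IsParity P S n ∧ InCode n P

theorem IsParity.congr {P P' : M.Num} {S S' : M.Num → Prop} {n : M.Num} (h : IsParity P S n)
    (h' : IsParity P' S' n) (hS : ∀ i, i < n → (S i ↔ S' i)) :
    ∀ i, i < n + 1 → (InCode i P ↔ InCode i P') := by
  refine Sig.induction (by infer_instance) ?_ ?_
  · intro _
    simp only [h.1, h'.1]
  · intro i ih hi
    have hin := lt_of_add_lt_add_right hi
    rw [h.2 i hin, h'.2 i hin, ih (hin.trans (lt_add_one _)), hS i hin]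

theorem exists_isParity {S : M.Num → Prop} (hS : Rec (fun v => S (v 0))) (n : M.Num) :
    ∃ P, IsParity P S n := by
  have : ∀ (s : (ℕ → M.Num) → M.Num) [RecFun s], Rec (fun v => S (s v)) :=
    fun s hs => hS.comp1 hs
  unfold IsParity
  refine Sig.induction (P := fun n => ∃ P, ¬ InCode 0 P ∧
    ∀ i, i < n → (InCode (i + 1) P ↔ ¬ (InCode i P ↔ S i))) (by infer_instance)
    ⟨0, not_inCode_zero _, fun i hi => (not_lt_zero' _ hi).elim⟩ ?_ n
  rintro n ⟨P, h0, hP⟩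
  obtain ⟨Q, -, hQ⟩ := exists_code
    (P := fun i => (i < n + 1 ∧ InCode i P) ∨ (i = n + 1 ∧ ¬ (InCode n P ↔ S n)))
    inferInstance (n + 1 + 1) (by
      rintro i (⟨h, -⟩ | ⟨rfl, -⟩)
      exacts [h.trans (lt_add_one _), lt_add_one _])
  have hQ' : ∀ i, i < n + 1 → (InCode i Q ↔ InCode i P) := fun i hi => by
    rw [hQ]
    simp [hi, hi.ne]
  refine ⟨Q, by rwa [hQ' 0 (add_one_pos _)], fun i hi => ?_⟩
  rw [hQ' i hi]
  rcases (lt_add_one_iff.1 hi).lt_or_eq with hi' | rfl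
  · rw [hQ' (i + 1) (by gcongr), hP i hi']
  · rw [hQ]
    simp

omit hM in
theorem OddBelow.congr {S S' : M.Num → Prop} {n : M.Num} (h : OddBelow S n)
    (hS : ∀ i, i < n → (S i ↔ S' i)) : OddBelow S' n := by
  obtain ⟨P, ⟨h0, hP⟩, hn⟩ := h
  exact ⟨P, ⟨h0, fun i hi => by rw [hP i hi, hS i hi]⟩, hn⟩

theorem IsParity.oddBelow_iff {P : M.Num} {S : M.Num → Prop} {n : M.Num} (h : IsParity P S n) :
    OddBelow S n ↔ InCode n P :=
  ⟨fun ⟨_, hQ, hn⟩ => (hQ.congr h (fun _ _ => Iff.rfl) n (lt_add_one _)).1 hn, fun hn => ⟨P, h, hn⟩⟩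

/-- The table for `S'` is that of `S` up to position `j` and its complement afterwards. -/
theorem oddBelow_of_flip {S S' : M.Num → Prop} (hS : Rec (fun v => S (v 0))) {n j : M.Num}
    (hj : j < n) (hne : ∀ i, i < n → ¬ i = j → (S' i ↔ S i)) (hSj : S' j ↔ ¬ S j)
    (h : ¬ OddBelow S n) : OddBelow S' n := by
  obtain ⟨P, hP⟩ := exists_isParity hS n
  rw [hP.oddBelow_iff] at h
  obtain ⟨Q, -, hQ⟩ := exists_code
    (P := fun i => i < n + 1 ∧ ((j < i ∧ ¬ InCode i P) ∨ (¬ j < i ∧ InCode i P)))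
    inferInstance (n + 1) fun i hi => hi.1
  have hlt : ∀ i, i < n + 1 → j < i → (InCode i Q ↔ ¬ InCode i P) := fun i hi hji => by
    rw [hQ]
    simp [hi, hji]
  have hle : ∀ i, i < n + 1 → ¬ j < i → (InCode i Q ↔ InCode i P) := fun i hi hji => by
    rw [hQ]
    simp only [hi, hji]
    simp
  refine ⟨Q, ⟨?_, fun i hi => ?_⟩, (hlt n (lt_add_one _) hj).2 h⟩
  · rw [hle 0 (add_one_pos _) (not_lt_zero' _)]
    exact hP.1
  · have hi1 : i + 1 < n + 1 := by gcongr
    have hi0 : i < n + 1 := hi.trans (lt_add_one _)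
    have hPi := hP.2 i hi
    rcases lt_trichotomy i j with hij | rfl | hij
    · rw [hle i hi0 hij.not_gt, hle (i + 1) hi1 (not_lt.2 (add_one_le_iff.2 hij)), hPi,
        hne i hi hij.ne]
    · rw [hle i hi0 (lt_irrefl _), hlt (i + 1) hi1 (lt_add_one _), hPi, hSj]
      tauto
    · rw [hlt i hi0 hij, hlt (i + 1) hi1 (hij.trans (lt_add_one _)), hPi, hne i hi hij.ne']
      tauto

/-- Two consecutive entries with the same truth value leave the parity unchanged, so it is even at
every even position. -/
theorem not_oddBelow_two_mul {S : M.Num → Prop} {k : M.Num} (c : Prop)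
    (hS : ∀ i, i < 2 * k → (S i ↔ c)) : ¬ OddBelow S (2 * k) := by
  rintro ⟨P, ⟨h0, hP⟩, h⟩
  have key : ∀ t, t < k + 1 → ¬ InCode (2 * t) P := by
    refine Sig.induction (by infer_instance) (fun _ => by rwa [mul_zero]) fun t ih ht => ?_
    have htk := lt_of_add_lt_add_right ht
    have ht2 : 2 * t + 1 < 2 * k := by
      obtain ⟨r, rfl⟩ := lt_iff_exists_add.1 htk
      exact lt_iff_exists_add.2 ⟨2 * r, by ring⟩
    have ht1 : 2 * t < 2 * k := (lt_add_one _).trans ht2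
    rw [show 2 * (t + 1) = 2 * t + 1 + 1 by ring, hP _ ht2, hP _ ht1, hS _ ht1, hS _ ht2]
    have := ih (htk.trans (lt_add_one _))
    tauto
  exact key k (lt_add_one _) h

instance Sig.oddBelow {S : M.Num → (ℕ → M.Num) → Prop} {t : (ℕ → M.Num) → M.Num}
    [hS : Rec (fun v => S (v 0) (tailVal v))] [ht : RecFun t] :
    Sig (fun v => OddBelow (fun i => S i v) (t v)) := by
  refine Sig.subst (P := fun b v => OddBelow (fun i => S i v) b) ?_ ht
  unfold OddBelow IsParity
  have : Rec fun v : ℕ → M.Num => S (v 0) (tailVal (tailVal (tailVal v))) :=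
    hS.ren (fun i => match i with | 0 => 0 | i + 1 => i + 3)
  infer_instance

/-- Parity tables exist and agree on the relevant range, so "not odd" is also existential: some
table omits the last position. -/
instance Rec.oddBelow {S : M.Num → (ℕ → M.Num) → Prop} {t : (ℕ → M.Num) → M.Num}
    [hS : Rec (fun v => S (v 0) (tailVal v))] [ht : RecFun t] :
    Rec (fun v => OddBelow (fun i => S i v) (t v)) := by
  refine ⟨inferInstance, ?_⟩
  have hc : Sig (fun v => ∃ P, IsParity P (fun i => S i v) (t v) ∧ ¬ InCode (t v) P) := by
    refine Sig.subst (P := fun b v => ∃ P, IsParity P (fun i => S i v) b ∧ ¬ InCode b P) ?_ ht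
    unfold IsParity
    have : Rec fun v : ℕ → M.Num => S (v 0) (tailVal (tailVal (tailVal v))) :=
      hS.ren (fun i => match i with | 0 => 0 | i + 1 => i + 3)
    infer_instance
  refine hc.congr fun v => ?_
  obtain ⟨P, hP⟩ := exists_isParity (S := fun i => S i v) ⟨hS.sig.fix v, Sig.fix (P := fun a v => ¬ S a v) hS.nsig v⟩ (t v)
  rw [hP.oddBelow_iff]
  refine ⟨fun h => ⟨P, hP, h⟩, fun ⟨Q, hQ, h⟩ => ?_⟩
  rwa [← hP.oddBelow_iff, hQ.oddBelow_iff]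

/-! ### Powers of two -/

/-- Primitive recursion through finite histories: each pair in the set `s` is the initial pair or is
justified by a predecessor in `s`. The history need not be a function; uniqueness of values follows
by induction. -/
theorem exists_powers_of_two : ∃ F : M.Num → M.Num, RecFun (fun v => F (v 0)) ∧ F 0 = 1 ∧
    ∀ e, F (e + 1) = 2 * F e := by
  set Q : M.Num → M.Num → Prop := fun e x => ∃ s, SeqVal s e x ∧ ∀ i, i < s → ∀ v, v < s →
    SeqVal s i v → (i = 0 ∧ v = 1) ∨ ∃ j, j < s ∧ ∃ w, w < s ∧
      (i = j + 1 ∧ v = 2 * w) ∧ SeqVal s j w with hQ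
  have h0 : Q 0 1 := by
    obtain ⟨s, -, hs⟩ := exists_insert (M := M) 0 (pair 0 1)
    refine ⟨s, (hs _).2 (.inr rfl), fun i _ v _ h => .inl ?_⟩
    exact pair_inj.1 (((hs _).1 h).resolve_left (not_inCode_zero _))
  have hsucc : ∀ e x, Q e x → Q (e + 1) (2 * x) := by
    rintro e x ⟨s, hs, hs'⟩
    obtain ⟨t, -, ht⟩ := exists_insert s (pair (e + 1) (2 * x))
    have hst : ∀ j w, SeqVal s j w → SeqVal t j w := fun j w h => (ht _).2 (.inl h)
    refine ⟨t, (ht _).2 (.inr rfl), fun i _ v _ h => ?_⟩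
    rcases (ht _).1 h with h | h
    · rcases hs' i (SeqVal.index_lt' h) v (SeqVal.lt h) h with h | ⟨j, -, w, -, hj, h⟩
      · exact .inl h
      · exact .inr ⟨j, (hst j w h).index_lt', w, (hst j w h).lt, hj, hst j w h⟩
    · exact .inr ⟨e, (hst e x hs).index_lt', x, (hst e x hs).lt, pair_inj.1 h, hst e x hs⟩
  have hex : ∀ e, ∃ x, Q e x := by
    refine Sig.induction ?_ ⟨1, h0⟩ fun e ⟨x, hx⟩ => ⟨_, hsucc e x hx⟩
    simp only [hQ]
    infer_instance
  have huniq : ∀ e x y, Q e x → Q e y → x = y := by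
    rintro e x y ⟨s, hs, hs'⟩ ⟨t, ht, ht'⟩
    have key : ∀ e, ∀ x, x < s → ∀ y, y < t → SeqVal s e x → SeqVal t e y → x = y := by
      refine Sig.induction (by infer_instance) ?_ ?_
      · intro x _ y _ hx hy
        rcases hs' _ hx.index_lt' _ hx.lt hx with h | ⟨j, -, w, -, hj, -⟩
        · rcases ht' _ hy.index_lt' _ hy.lt hy with h' | ⟨j, -, w, -, hj, -⟩
          · rw [h.2, h'.2]
          · exact (add_one_ne_zero _ hj.1.symm).elim
        · exact (add_one_ne_zero _ hj.1.symm).elim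
      · intro e ih x _ y _ hx hy
        rcases hs' _ hx.index_lt' _ hx.lt hx with h | ⟨j, -, w, -, ⟨hj, rfl⟩, hw⟩
        · exact (add_one_ne_zero _ h.1).elim
        · rcases ht' _ hy.index_lt' _ hy.lt hy with h' | ⟨j', -, w', -, ⟨hj', rfl⟩, hw'⟩
          · exact (add_one_ne_zero _ h'.1).elim
          · obtain rfl := add_right_cancel hj
            obtain rfl := add_right_cancel hj'
            rw [ih w hw.lt w' hw'.lt hw hw']
    exact key e x hs.lt y ht.lt hs ht
  choose F hF using hex
  have hFQ : ∀ e x, x = F e ↔ Q e x := fun e x =>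
    ⟨fun h => h ▸ hF e, fun h => huniq e _ _ h (hF e)⟩
  refine ⟨F, ⟨?_⟩, ((hFQ _ _).2 h0).symm, fun e => ((hFQ _ _).2 (hsucc _ _ (hF e))).symm⟩
  simp only [hFQ, hQ]
  infer_instance

/-! ### Injective finite sequences -/

/-- `y` is the code of an injective finite sequence of length `n`. -/
def IsInjSeq (n y : M.Num) : Prop :=
  IsSeq n y ∧ ∀ i, i < y → ∀ j, j < y → ∀ v, v < y → SeqVal y i v → SeqVal y j v → i = j

theorem IsInjSeq.inj {n y i j v : M.Num} (hy : IsInjSeq n y) (hi : SeqVal y i v)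
    (hj : SeqVal y j v) : i = j := hy.2 i hi.index_lt' j hj.index_lt' v hi.lt hi hj

instance Rec.isInjSeq {s t : (ℕ → M.Num) → M.Num} [hs : RecFun s] [ht : RecFun t] :
    Rec (fun v => IsInjSeq (s v) (t v)) := by
  refine .comp2 (P := IsInjSeq) ?_ hs ht
  unfold IsInjSeq
  infer_instance

theorem isInjSeq_zero : IsInjSeq (0 : M.Num) 0 :=
  ⟨⟨isFinCode_zero, fun _ h => (not_inCode_zero _ h).elim, fun _ h => (not_lt_zero' _ h).elim⟩,
    fun _ h => (not_lt_zero' _ h).elim⟩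

theorem IsSeq.exists_snoc {n y : M.Num} (hy : IsSeq n y) (z : M.Num) :
    ∃ y', IsSeq (n + 1) y' ∧ ∀ i v, SeqVal y' i v ↔ SeqVal y i v ∨ (i = n ∧ v = z) := by
  obtain ⟨y', hy', h⟩ := exists_insert y (pair n z)
  have hval : ∀ i v, SeqVal y' i v ↔ SeqVal y i v ∨ (i = n ∧ v = z) := fun i v =>
    (h _).trans (or_congr_right pair_inj)
  refine ⟨y', ⟨hy', fun p hp => ?_, fun i hi => ?_⟩, hval⟩
  · rcases (h p).1 hp with hp | rfl
    · obtain ⟨i, v, hi, rfl⟩ := hy.2.1 p hp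
      exact ⟨i, v, hi.trans (lt_add_one _), rfl⟩
    · exact ⟨n, z, lt_add_one _, rfl⟩
  · rcases (lt_add_one_iff.1 hi).lt_or_eq with hi | rfl
    · obtain ⟨v, hv⟩ := hy.exists_val hi
      refine ⟨v, (hval i v).2 (.inl hv), fun w hw => ?_⟩
      rcases (hval i w).1 hw with hw | ⟨rfl, -⟩
      exacts [hy.unique hw hv, (lt_irrefl _ hi).elim]
    · refine ⟨z, (hval i z).2 (.inr ⟨rfl, rfl⟩), fun w hw => ?_⟩
      rcases (hval i w).1 hw with hw | ⟨-, rfl⟩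
      exacts [(lt_irrefl _ (hy.index_lt hw)).elim, rfl]

/-- A pigeonhole principle: if at most `N` values are forbidden, then an injective sequence of
length `L + N` can be thinned out to one of length `L` which avoids them. -/
theorem IsInjSeq.exists_avoiding {L N z : M.Num} (hz : IsInjSeq (L + N) z) {w : M.Num}
    (hw : ∀ s v v', SeqVal w s v → SeqVal w s v' → v = v') :
    ∃ z', IsInjSeq L z' ∧ ∀ i v, SeqVal z' i v →
      (∃ j, SeqVal z j v) ∧ ∀ s, s < N → ¬ SeqVal w s v := by
  have key : ∀ t, t < N + 1 → ∃ z' l, l + t = L + N ∧ IsInjSeq l z' ∧ ∀ i, i < z' → ∀ v, v < z' →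
      SeqVal z' i v → (∃ j, SeqVal z j v) ∧ ∀ s, s < t → ¬ SeqVal w s v := by
    refine Sig.induction (by infer_instance) ?_ ?_
    · intro _
      exact ⟨z, L + N, add_zero _, hz, fun i _ v _ h =>
        ⟨⟨i, h⟩, fun s hs => (not_lt_zero' _ hs).elim⟩⟩
    · intro t ih ht
      have htN := lt_of_add_lt_add_right ht
      obtain ⟨z', l, hl, hz', hav⟩ := ih (htN.trans (lt_add_one _))
      obtain ⟨l, rfl⟩ : ∃ k, l = k + 1 := by
        refine (eq_zero_or_eq_add_one l).resolve_left ?_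
        rintro rfl
        rw [zero_add] at hl
        exact not_lt.2 le_add_self (hl ▸ htN)
      -- `k` is the only place where the forbidden value `w_t` can occur; if it does not occur, the
      -- default place `0` serves.
      obtain ⟨k, hk⟩ : ∃ k, ∀ j v, SeqVal w t v → SeqVal z' j v → j = k := by
        by_cases h : ∃ j v, SeqVal w t v ∧ SeqVal z' j v
        · obtain ⟨k, v, hv, hk⟩ := h
          exact ⟨k, fun j v' hv' hj => hz'.inj hj (hw t v v' hv hv' ▸ hk)⟩
        · exact ⟨0, fun j v hv hj => (h ⟨j, v, hv, hj⟩).elim⟩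
      -- Entry `k` is overwritten by the last entry, and the length drops by one. This happens even
      -- if `w_t` does not occur, so that `l + t = L + N` stays exact.
      obtain ⟨u, hu, hval⟩ := exists_isSeq
        (P := fun i v => (i = k ∧ SeqVal z' l v) ∨ (¬ i = k ∧ SeqVal z' i v))
        inferInstance l z' (fun i hi => by
          by_cases hik : i = k
          · simp only [hik, true_and, not_true, false_and, or_false]
            exact hz'.1.2.2 l (lt_add_one _)
          · simp only [hik, false_and, not_false_eq_true, true_and, false_or]
            exact hz'.1.2.2 i (hi.trans (lt_add_one _)))
        (by
          rintro i v - (⟨-, h⟩ | ⟨-, h⟩) <;> exact h.lt)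
      refine ⟨u, l, by rw [← hl]; ring, ⟨hu, fun i _ j _ v _ hi hj => ?_⟩,
        fun i _ v _ hi => ?_⟩
      · obtain ⟨hil, hi⟩ := (hval i v).1 hi
        obtain ⟨hjl, hj⟩ := (hval j v).1 hj
        rcases hi with ⟨rfl, hi⟩ | ⟨hik, hi⟩ <;> rcases hj with ⟨rfl, hj⟩ | ⟨hjk, hj⟩
        · rfl
        · exact (hjl.ne (hz'.inj hj hi)).elim
        · exact (hil.ne (hz'.inj hi hj)).elim
        · exact hz'.inj hi hj
      · obtain ⟨hil, hi⟩ := (hval i v).1 hi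
        obtain ⟨j, hj, hjk⟩ : ∃ j, SeqVal z' j v ∧ ¬ j = k := by
          rcases hi with ⟨rfl, hi⟩ | ⟨hik, hi⟩
          · exact ⟨l, hi, hil.ne'⟩
          · exact ⟨i, hi, hik⟩
        obtain ⟨h1, h2⟩ := hav j hj.index_lt' v hj.lt hj
        refine ⟨h1, fun s hs hsv => ?_⟩
        rcases (lt_add_one_iff.1 hs).lt_or_eq with hs | rfl
        · exact h2 s hs hsv
        · exact hjk (hk j v hsv hj)
  obtain ⟨z', l, hl, hz', h⟩ := key N (lt_add_one _)
  obtain rfl := add_right_cancel hl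
  exact ⟨z', hz', fun i v hv => h i hv.index_lt' v hv.lt hv⟩

end L2Structure

namespace L2Structure

variable {M : L2Structure.{u}} [hM : Model M]

/-! ### The affine relation of odd parity -/

/-- `R` is the relation of arity `n + 1` which holds if the number of true arguments among the
first `n` is odd. -/
def IsOddRel (n R : M.Num) : Prop :=
  IsFinCode R ∧ ∀ σ, InCode σ R ↔ IsVector (n + 1) σ ∧ OddBelow (fun i => InCode i σ) n

instance Rec.isVector {s t : (ℕ → M.Num) → M.Num} [hs : RecFun s] [ht : RecFun t] :
    Rec (fun v => IsVector (s v) (t v)) := by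
  refine .comp2 (P := IsVector) ?_ hs ht
  have : ∀ n σ : M.Num, IsVector n σ ↔ IsFinCode σ ∧ ∀ i, i < σ → InCode i σ → i < n :=
    fun n σ => and_congr_right fun _ => ⟨fun h i _ hi => h i hi, fun h i hi => h i hi.lt hi⟩
  simp only [this]
  infer_instance

instance Rec.isOddRel {s t : (ℕ → M.Num) → M.Num} [hs : RecFun s] [ht : RecFun t] :
    Rec (fun v => IsOddRel (s v) (t v)) := by
  refine .comp2 (P := IsOddRel) ?_ hs ht
  obtain ⟨b, hb, hb'⟩ := Rec.exists_fun (M := M) (P := IsCodeBound) inferInstance exists_isCodeBound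
  have : ∀ (s : (ℕ → M.Num) → M.Num) [RecFun s], RecFun (fun v => b (s v)) := fun s hs => hb.comp1 hs
  -- The recursive bound `b` covers every vector of length `n + 1`, and `R` exceeds all its own
  -- members; beyond both, the two sides are false.
  have h : ∀ n R : M.Num, IsOddRel n R ↔ IsFinCode R ∧ ∀ σ, σ < R + b (n + 1) + 1 →
      (InCode σ R ↔ IsVector (n + 1) σ ∧ OddBelow (fun i => InCode i σ) n) := fun n R =>
    and_congr_right fun _ => ⟨fun h σ _ => h σ, fun h σ => ⟨fun hσ => (h σ ?_).1 hσ,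
      fun hσ => (h σ ?_).2 hσ⟩⟩
  · simp only [h]
    infer_instance
  · rw [add_assoc]
    exact hσ.lt.trans_le le_self_add
  · exact lt_add_one_iff.2 (((hb' _).le hσ.1).trans le_add_self)

theorem exists_isOddRel (n : M.Num) : ∃ R, IsOddRel n R := by
  obtain ⟨b, hb⟩ := exists_isCodeBound (n + 1)
  exact exists_code (P := fun σ => IsVector (n + 1) σ ∧ OddBelow (fun i => InCode i σ) n)
    inferInstance (b + 1) fun σ hσ => lt_add_one_iff.2 (hb.le hσ.1)

/-- A single equation suffices, with index set `{i | i < n}` and right-hand side `1`; the last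
coordinate is free. -/
theorem IsOddRel.isAffine {n R : M.Num} (hR : IsOddRel n R) : IsAffine (n + 1) R := by
  obtain ⟨J, hJ, hJ'⟩ := exists_code (P := fun i : M.Num => i < n) inferInstance n fun _ h => h
  have hJv : IsVector (n + 1) J := ⟨hJ, fun i hi => ((hJ' i).1 hi).trans (lt_add_one _)⟩
  obtain ⟨φ, hφ, hφ'⟩ := exists_insert 0 (pair J 1)
  have hφ1 : ∀ ε, InCode ε φ ↔ ε = pair J 1 := fun ε =>
    (hφ' ε).trans (or_iff_right (not_inCode_zero _))
  refine ⟨⟨hR.1, fun σ hσ => ((hR.2 σ).1 hσ).1⟩, φ, ⟨hφ, fun ε hε =>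
    ⟨J, 1, (hφ1 ε).1 hε, hJv, .inr rfl⟩⟩, fun σ hσ => ?_⟩
  have hx : (∀ J b, InCode (pair J b) φ → XorEq (n + 1) σ J b) ↔ XorEq (n + 1) σ J 1 := by
    simp only [hφ1, pair_inj]
    constructor
    · exact fun h => h J 1 ⟨rfl, rfl⟩
    · rintro h J b ⟨rfl, rfl⟩
      exact h
  rw [hx, hR.2, and_iff_right hσ]
  have hn : ∀ i, i < n → ((InCode i σ ∧ InCode i J) ↔ InCode i σ) := fun i hi =>
    and_iff_left ((hJ' i).2 hi)
  have hnn : ¬ (InCode n σ ∧ InCode n J) := fun h => lt_irrefl _ ((hJ' n).1 h.2)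
  obtain ⟨P, hP⟩ := exists_isParity (S := fun i => InCode i σ ∧ InCode i J) inferInstance (n + 1)
  have hP' : IsParity P (fun i => InCode i σ) n := ⟨hP.1, fun i hi => by
    rw [hP.2 i (hi.trans (lt_add_one _))]
    exact not_congr (iff_congr Iff.rfl (hn i hi))⟩
  -- Index `n` is not in `J`, so the ignored coordinate does not change the parity.
  have hlast : InCode (n + 1) P ↔ InCode n P := by
    rw [hP.2 n (lt_add_one _)]
    tauto
  rw [hP'.oddBelow_iff, ← hlast]
  constructor
  · exact fun h => ⟨P, hP.1, hP.2, iff_of_true h rfl⟩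
  · rintro ⟨Q, hQ0, hQ, h⟩
    exact (IsParity.congr ⟨hQ0, hQ⟩ hP (fun _ _ => Iff.rfl) _ (lt_add_one _)).1 (h.2 rfl)

/-! ### The set of clauses -/

/-- `θ` is the formula which says that the number of true variables among `y_0, …, y_{n-1}` is odd,
with the further variable `z`. -/
def IsOddClause (n y z θ : M.Num) : Prop :=
  ∃ R, R < θ + 1 ∧ ∃ y', y' < θ + 1 ∧ θ = pair (n + 1) (pair R y') ∧ IsOddRel n R ∧
    IsSeq (n + 1) y' ∧ (∀ i, i < y → ∀ v, v < y → SeqVal y i v → SeqVal y' i v) ∧ SeqVal y' n z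

theorem exists_isOddClause {n y : M.Num} (hy : IsSeq n y) (z : M.Num) :
    ∃ θ, IsOddClause n y z θ := by
  obtain ⟨R, hR⟩ := exists_isOddRel n
  obtain ⟨y', hy', h⟩ := hy.exists_snoc z
  exact ⟨_, R, lt_add_one_iff.2 ((left_le_pair _ _).trans (right_le_pair _ _)), y',
    lt_add_one_iff.2 ((right_le_pair _ _).trans (right_le_pair _ _)), rfl, hR, hy',
    fun i _ v _ hv => (h i v).2 (.inl hv), (h n z).2 (.inr ⟨rfl, rfl⟩)⟩

/-- This is the purpose of the further variable: a witness coded into `z` is bounded by the formula.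
-/
theorem IsOddClause.lt {n y z θ : M.Num} (h : IsOddClause n y z θ) : z < θ := by
  obtain ⟨R, -, y', -, rfl, -, -, -, hz⟩ := h
  exact hz.lt.trans_le ((right_le_pair _ _).trans (right_le_pair _ _))

theorem IsOddClause.isFormula {n y z θ : M.Num} (h : IsOddClause n y z θ) {V : Set M.Num}
    (hV : ∀ v, v ∈ V) : IsFormula IsAffine V θ := by
  obtain ⟨R, -, y', -, h, hR, hy', -⟩ := h
  exact ⟨n + 1, R, y', h, hR.isAffine, hy', fun _ v _ _ => hV v⟩

/-- The number of `j < n` such that the variable `y_j` is in `ν` is odd. -/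
def OddTrue (n y : M.Num) (ν : M.Num → Prop) : Prop :=
  OddBelow (fun j => ∃ v, v < y ∧ SeqVal y j v ∧ ν v) n

theorem IsSeq.exists_lt_seqVal_and {n y j v : M.Num} (hy : IsSeq n y) (hv : SeqVal y j v)
    (ν : M.Num → Prop) : (∃ w, w < y ∧ SeqVal y j w ∧ ν w) ↔ ν v := by
  constructor
  · rintro ⟨w, -, hw, hν⟩
    rwa [hy.unique hv hw]
  · exact fun h => ⟨v, hv.lt, hv, h⟩

theorem IsOddClause.satisfies {n y z θ : M.Num} (h : IsOddClause n y z θ) (hy : IsSeq n y)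
    {ν : M.Num} (hν : OddTrue n y (fun v => InCode v ν)) : Satisfies {v | InCode v ν} θ := by
  obtain ⟨R, -, y', -, hθ, hR, hy', hyy', -⟩ := h
  obtain ⟨σ, hσ, hσ'⟩ := exists_code
    (P := fun i => i < n + 1 ∧ ∃ v, v < y' ∧ SeqVal y' i v ∧ InCode v ν) inferInstance (n + 1)
    fun i hi => hi.1
  refine ⟨n + 1, R, y', hθ, σ, (hR.2 σ).2 ⟨⟨hσ, fun i hi => ((hσ' i).1 hi).1⟩, ?_⟩, ?_⟩
  · refine hν.congr fun i hi => ?_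
    obtain ⟨v, hv⟩ := hy.exists_val hi
    rw [hy.exists_lt_seqVal_and hv, hσ',
      hy'.exists_lt_seqVal_and (hyy' i hv.index_lt' v hv.lt hv) (fun v => InCode v ν),
      and_iff_right (hi.trans (lt_add_one _))]
  · intro i v hi hv
    rw [hσ', hy'.exists_lt_seqVal_and hv (fun v => InCode v ν), and_iff_right hi]
    rfl

/-- A formula `y_0 ⊕ ⋯ ⊕ y_{2k-1} = 1` is not satisfied by an assignment which is constant on its
variables. -/
theorem IsOddClause.not_satisfies {k y z θ : M.Num} (h : IsOddClause (2 * k) y z θ)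
    (hy : IsSeq (2 * k) y) {ν : Set M.Num} (c : Prop) (hc : ∀ i v, SeqVal y i v → (v ∈ ν ↔ c)) :
    ¬ Satisfies ν θ := by
  obtain ⟨R, -, y', -, rfl, hR, hy', hyy', -⟩ := h
  rintro ⟨n', R', y'', h, σ, hσ, hσν⟩
  obtain ⟨hn, h⟩ := pair_inj.1 h
  obtain ⟨rfl, rfl⟩ := pair_inj.1 h
  subst hn
  refine not_oddBelow_two_mul c (fun i hi => ?_) ((hR.2 σ).1 hσ).2
  obtain ⟨v, hv⟩ := hy.exists_val hi
  rw [hσν i v (hi.trans (lt_add_one _)) (hyy' i hv.index_lt' v hv.lt hv), hc i v hv]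

/-! ### Finite satisfiability of the parity clauses -/

section Consistency

variable {F : M.Num → M.Num} {D : M.Num → M.Num → Prop}

theorem two_mul_le_of_lt (hF : RecFun (fun v => F (v 0))) (hF1 : ∀ e, F (e + 1) = 2 * F e)
    {i e : M.Num} (h : i < e) : 2 * F i ≤ F e := by
  have : ∀ (s : (ℕ → M.Num) → M.Num) [RecFun s], RecFun (fun v => F (s v)) :=
    fun s hs => hF.comp1 hs
  have key : ∀ k, 2 * F i ≤ F (i + k + 1) := by
    refine Sig.induction (by infer_instance) ?_ ?_
    · rw [add_zero, hF1]
    · intro k ih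
      rw [← add_assoc, hF1]
      exact ih.trans (le_mul_of_pos zero_lt_two)
  obtain ⟨k, rfl⟩ := lt_iff_exists_add.1 h
  exact key k

/-- Among `2 ^ (e + 1)` elements there is one which avoids sets of `2, 4, …, 2 ^ e` elements. -/
theorem exists_pivot (hF : RecFun (fun v => F (v 0))) (hF0 : F 0 = 1)
    (hF1 : ∀ e, F (e + 1) = 2 * F e) (hD : Rec (fun v => D (v 0) (v 1)))
    (hDs : ∀ e y, D e y → IsInjSeq (2 * F e) y) (hDu : ∀ e y y', D e y → D e y' → y = y')
    {K e y : M.Num} (hy : D e y) :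
    ∃ j x, SeqVal y j x ∧ ∀ i, i < e → ∀ y', y' < K → D i y' → ∀ s, ¬ SeqVal y' s x := by
  have : ∀ (s : (ℕ → M.Num) → M.Num) [RecFun s], RecFun (fun v => F (s v)) :=
    fun s hs => hF.comp1 hs
  have : ∀ (s t : (ℕ → M.Num) → M.Num) [RecFun s] [RecFun t], Rec (fun v => D (s v) (t v)) :=
    fun s t hs ht => hD.comp2 hs ht
  -- After the sequences with index below `i` are avoided, `2^(e+1) - (2^(i+1) - 2)` elements
  -- remain; the equation for `l` says this additively. At `i = e` two are left.
  have key : ∀ i, i < e + 1 → ∃ z l, l + 2 * F i = 2 * F e + 2 ∧ IsInjSeq l z ∧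
      ∀ j, j < z → ∀ v, v < z → SeqVal z j v → (∃ j', SeqVal y j' v) ∧
        ∀ i', i' < i → ∀ y', y' < K → D i' y' → ∀ s, s < y' → ¬ SeqVal y' s v := by
    refine Sig.induction (by infer_instance) ?_ ?_
    · intro _
      exact ⟨y, 2 * F e, by rw [hF0, mul_one], hDs e y hy, fun j _ v _ hv =>
        ⟨⟨j, hv⟩, fun i' hi' => (not_lt_zero' _ hi').elim⟩⟩
    · intro i ih hi
      have hie := lt_of_add_lt_add_right hi
      obtain ⟨z, l, hl, hz, hav⟩ := ih (hie.trans (lt_add_one _))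
      obtain ⟨r, hr⟩ := le_iff_exists_eq_add.1 (two_mul_le_of_lt hF hF1 hie)
      obtain rfl : l = (2 * r + 2) + 2 * F i := by
        refine add_right_cancel (b := 2 * F i) ?_
        rw [hl, hr]
        ring
      -- If no sequence is assigned to `i`, the empty one (code `0`) is avoided instead; the
      -- thinning discards `2 * F i` entries in either case.
      obtain ⟨w, hw⟩ : ∃ w, (∀ y', y' < K → D i y' → w = y') ∧
          ∀ s v v', SeqVal w s v → SeqVal w s v' → v = v' := by
        by_cases h : ∃ y', D i y'
        · obtain ⟨w, hw⟩ := h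
          exact ⟨w, fun y' _ h => hDu i w y' hw h, fun s v v' => (hDs i w hw).1.unique⟩
        · exact ⟨0, fun y' _ hy' => (h ⟨y', hy'⟩).elim,
            fun s v v' hv => (not_inCode_zero _ hv).elim⟩
      obtain ⟨z', hz', hav'⟩ := hz.exists_avoiding hw.2
      refine ⟨z', _, ?_, hz', fun j _ v _ hv => ?_⟩
      · rw [hF1, hr]
        ring
      · obtain ⟨⟨j', hj'⟩, hN⟩ := hav' j v hv
        obtain ⟨hyv, hlt⟩ := hav j' hj'.index_lt' v hj'.lt hj'
        refine ⟨hyv, fun i' hi' y' hy' hDy' s hs hsv => ?_⟩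
        rcases (lt_add_one_iff.1 hi').lt_or_eq with hi' | rfl
        · exact hlt i' hi' y' hy' hDy' s hs hsv
        · obtain rfl := hw.1 y' hy' hDy'
          exact hN s ((hDs _ _ hDy').1.index_lt hsv) hsv
  obtain ⟨z, l, hl, hz, hav⟩ := key e (lt_add_one _)
  obtain rfl : l = 2 := add_right_cancel (hl.trans (add_comm _ _))
  obtain ⟨v, hv⟩ := hz.1.exists_val zero_lt_two
  obtain ⟨⟨j, hj⟩, h⟩ := hav 0 hv.index_lt' v hv.lt hv
  exact ⟨j, v, hj, fun i hi y' hy' hDy' s hs => h i hi y' hy' hDy' s hs.index_lt' hs⟩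

/-- Triangular elimination: an equation that fails at stage `e` is repaired by flipping its pivot,
which occurs in no sequence with smaller index. The bound `K` keeps the induction formula `Σ⁰₁`. -/
theorem exists_assignment (hF : RecFun (fun v => F (v 0))) (hF0 : F 0 = 1)
    (hF1 : ∀ e, F (e + 1) = 2 * F e) (hD : Rec (fun v => D (v 0) (v 1)))
    (hDs : ∀ e y, D e y → IsInjSeq (2 * F e) y) (hDu : ∀ e y y', D e y → D e y' → y = y')
    (K e : M.Num) : ∃ ν, ∀ i, i < e → ∀ y, y < K → D i y →
      OddTrue (2 * F i) y (fun v => InCode v ν) := by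
  have : ∀ (s : (ℕ → M.Num) → M.Num) [RecFun s], RecFun (fun v => F (s v)) :=
    fun s hs => hF.comp1 hs
  have : ∀ (s t : (ℕ → M.Num) → M.Num) [RecFun s] [RecFun t], Rec (fun v => D (s v) (t v)) :=
    fun s t hs ht => hD.comp2 hs ht
  unfold OddTrue
  refine Sig.induction (P := fun e => ∃ ν, ∀ i, i < e → ∀ y, y < K → D i y →
    OddBelow (fun j => ∃ v, v < y ∧ SeqVal y j v ∧ InCode v ν) (2 * F i)) (by infer_instance)
    ⟨0, fun i hi => (not_lt_zero' _ hi).elim⟩ ?_ e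
  rintro e ⟨ν, hν⟩
  by_cases hy : ∃ y, y < K ∧ D e y ∧ ¬ OddTrue (2 * F e) y (fun v => InCode v ν)
  · obtain ⟨y, hyK, hDy, hodd⟩ := hy
    obtain ⟨j, x, hx, hpiv⟩ := exists_pivot hF hF0 hF1 hD hDs hDu (K := K) hDy
    obtain ⟨ν', -, hν'⟩ := exists_code
      (P := fun i => (¬ i = x ∧ InCode i ν) ∨ (i = x ∧ ¬ InCode x ν)) inferInstance (ν + x + 1) (by
        rintro i (⟨-, h⟩ | ⟨rfl, -⟩)
        · rw [add_assoc]
          exact h.lt.trans_le le_self_add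
        · exact lt_add_one_iff.2 le_add_self)
    have hne : ∀ v, ¬ v = x → (InCode v ν' ↔ InCode v ν) := fun v hv => by
      rw [hν']
      simp [hv]
    have hxν : InCode x ν' ↔ ¬ InCode x ν := by
      rw [hν']
      simp
    refine ⟨ν', fun i hi y' hy'K hDy' => ?_⟩
    rcases (lt_add_one_iff.1 hi).lt_or_eq with hi | rfl
    · refine (hν i hi y' hy'K hDy').congr fun j _ => exists_congr fun v => and_congr_right fun _ =>
        and_congr_right fun hv => (hne v ?_).symm
      rintro rfl
      exact hpiv i hi y' hy'K hDy' j hv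
    · obtain rfl := hDu _ _ _ hDy hDy'
      have hseq := hDs _ _ hDy
      refine oddBelow_of_flip (by infer_instance) (hseq.1.index_lt hx) (fun i hi hij => ?_) ?_ hodd
      · refine exists_congr fun v => and_congr_right fun _ => and_congr_right fun hv => hne v ?_
        rintro rfl
        exact hij (hseq.inj hv hx)
      · rw [hseq.1.exists_lt_seqVal_and hx (fun v => InCode v ν'),
          hseq.1.exists_lt_seqVal_and hx (fun v => InCode v ν), hxν]
  · push Not at hy
    refine ⟨ν, fun i hi y hyK hDy => ?_⟩
    rcases (lt_add_one_iff.1 hi).lt_or_eq with hi | rfl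
    exacts [hν i hi y hyK hDy, hy y hyK hDy]

end Consistency

/-! ### Infinite homogeneous sets and diagonal non-computability -/

theorem exists_isInjSeq_of_isInfinite {H : Set M.Num} (hH : H ∈ M.sets) (hinf : M.IsInfinite H)
    (n : M.Num) : ∃ y, IsInjSeq n y ∧ ∀ i, i < y → ∀ v, v < y → SeqVal y i v → v ∈ H := by
  have : ∀ (s : (ℕ → M.Num) → M.Num) [RecFun s], Rec (fun v => s v ∈ H) :=
    fun s hs => Rec.mem hH hs
  refine Sig.induction (P := fun n => ∃ y, IsInjSeq n y ∧
    ∀ i, i < y → ∀ v, v < y → SeqVal y i v → v ∈ H) (by infer_instance)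
    ⟨0, isInjSeq_zero, fun i hi => (not_lt_zero' _ hi).elim⟩ ?_ n
  rintro n ⟨y, hy, hyH⟩
  -- Every entry of `y` is smaller than the code `y`, so an element not below the code is new.
  obtain ⟨h, hhH, hh⟩ : ∃ h ∈ H, ¬ h < y := by
    by_contra! hc
    exact hinf ⟨y, hc⟩
  obtain ⟨y', hy', hval⟩ := hy.1.exists_snoc h
  refine ⟨y', ⟨hy', fun i _ j _ v _ hi hj => ?_⟩, fun i _ v _ hi => ?_⟩
  · rcases (hval i v).1 hi with hi | ⟨rfl, rfl⟩ <;> rcases (hval j _).1 hj with hj | ⟨rfl, hv⟩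
    · exact hy.inj hi hj
    · exact (hh (hv ▸ hi.lt)).elim
    · exact (hh hj.lt).elim
    · rfl
  · rcases (hval i v).1 hi with hi | ⟨-, rfl⟩
    exacts [hyH i hi.index_lt' v hi.lt hi, hhH]

theorem exists_isFunction_of_recFun {g : M.Num → M.Num} (hg : RecFun (fun v => g (v 0))) :
    ∃ f ∈ M.sets, M.IsFunction f ∧ ∀ e y, pair e y ∈ f → y = g e := by
  have : ∀ (s : (ℕ → M.Num) → M.Num) [RecFun s], RecFun (fun v => g (s v)) :=
    fun s hs => hg.comp1 hs
  have hmem : ∀ e y, (∃ e', e' < pair e y + 1 ∧ pair e y = pair e' (g e')) ↔ y = g e := by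
    intro e y
    constructor
    · rintro ⟨e', -, h⟩
      obtain ⟨rfl, rfl⟩ := pair_inj.1 h
      rfl
    · rintro rfl
      exact ⟨e, lt_add_one_iff.2 (left_le_pair _ _), rfl⟩
  refine ⟨{p | ∃ e, e < p + 1 ∧ p = pair e (g e)}, setOf_mem_sets (by infer_instance),
    ⟨fun p ⟨e, _, h⟩ => ⟨e, g e, h⟩, fun x => ⟨g x, (hmem x _).2 rfl, fun y hy => (hmem x y).1 hy⟩⟩,
    fun e y h => (hmem e y).1 h⟩

set_option synthInstance.maxSize 2000 in
theorem exists_dnr_of_rsatAffine (hR : M.RSATAffine) {X : Set M.Num} (hX : X ∈ M.sets) :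
    ∃ f ∈ M.sets, M.IsFunction f ∧ ∀ e y, pair e y ∈ f → ¬ Computes X e e y := by
  obtain ⟨F, hF, hF0, hF1⟩ := exists_powers_of_two (M := M)
  have hFi : ∀ (s : (ℕ → M.Num) → M.Num) [RecFun s], RecFun (fun v => F (s v)) :=
    fun s hs => hF.comp1 hs
  obtain ⟨Q, hQ, hQ'⟩ := (Sig.comp3 (sig_computes hX) (.var 0) (.var 0) (.var 1)).out
  -- `T a e y` says that `a` witnesses `Φ_e^X(e) = y`; the remaining variables of the matrix get the
  -- dummy value `y`.
  set T : M.Num → M.Num → M.Num → Prop := fun a e y =>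
    Q a (consVal e fun _ => y)
  have hTr : Rec (fun v => T (v 0) (v 1) (v 2)) := by
    exact (hQ.ren (fun i => match i with | 0 => 0 | 1 => 1 | _ => 2)).rec.congr fun v =>
      iff_of_eq (congrArg (Q (v 0)) (funext fun i => by cases i <;> rfl))
  have hTi : ∀ (r s t : (ℕ → M.Num) → M.Num) [RecFun r] [RecFun s] [RecFun t],
    Rec (fun v => T (r v) (s v) (t v)) := fun r s t hr hs ht => hTr.comp3 hr hs ht
  have hTc : ∀ e y, Computes X e e y ↔ ∃ a, T a e y := fun e y => hQ' (consVal e fun _ => y)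
  -- The variable `pair a (pair e y)` makes `a`, `e` and `y` smaller than `θ`, so the bounds lose
  -- nothing and `C` is `Δ⁰₁`.
  set C : Set M.Num := {θ | ∃ a, a < θ ∧ ∃ e, e < θ ∧ ∃ y, y < θ ∧ T a e y ∧
    IsInjSeq (2 * F e) y ∧ IsOddClause (2 * F e) y (pair a (pair e y)) θ}
  have hC : C ∈ M.sets := by
    refine setOf_mem_sets ?_
    unfold IsOddClause
    infer_instance
  have hV : {n : M.Num | n = n} ∈ M.sets := setOf_mem_sets (by infer_instance)
  obtain ⟨H, hH, hHinf, -, c, hc⟩ := hR _ hV (fun ⟨k, hk⟩ => lt_irrefl k (hk k rfl)) C hC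
    (by
      rintro θ ⟨a, -, e, -, y, -, -, -, hθ⟩
      exact hθ.isFormula fun v => rfl)
    (by
      rintro E hE ⟨K, hK⟩ hEC
      -- `K` bounds the clauses of `E` and so also their witnesses. Truncating to `a < K` makes the
      -- assignment of sequences to indices `Δ⁰₁`, and determinism makes it single-valued.
      obtain ⟨ν, hν⟩ := exists_assignment
        (D := fun e y => (∃ a, a < K ∧ T a e y) ∧ IsInjSeq (2 * F e) y) hF hF0 hF1
        (by infer_instance) (fun e y h => h.2)
        (fun e y y' ⟨⟨a, _, h⟩, _⟩ ⟨⟨a', _, h'⟩, _⟩ =>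
          Computes.unique ((hTc e y).2 ⟨a, h⟩) ((hTc e y').2 ⟨a', h'⟩)) K K
      refine ⟨{v | InCode v ν}, setOf_mem_sets (by infer_instance), fun θ hθ => ?_⟩
      obtain ⟨a, ha, e, he, y, hy, hTa, hyi, hcl⟩ := hEC hθ
      have hθK := hK θ hθ
      exact hcl.satisfies hyi.1 (hν e (he.trans hθK) y (hy.trans hθK)
        ⟨⟨a, ha.trans hθK, hTa⟩, hyi⟩))
  have : ∀ (s : (ℕ → M.Num) → M.Num) [RecFun s], Rec (fun v => s v ∈ H) :=
    fun s hs => Rec.mem hH hs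
  obtain ⟨g, hg, hgH⟩ := Rec.exists_fun (M := M)
    (P := fun e y => IsInjSeq (2 * F e) y ∧ ∀ i, i < y → ∀ v, v < y → SeqVal y i v → v ∈ H)
    (by infer_instance) fun e => exists_isInjSeq_of_isInfinite hH hHinf _
  obtain ⟨f, hf, hfun, hfg⟩ := exists_isFunction_of_recFun hg
  refine ⟨f, hf, hfun, fun e y hey hcomp => ?_⟩
  obtain rfl := hfg e y hey
  obtain ⟨a, ha⟩ := (hTc _ _).1 hcomp
  obtain ⟨hyi, hyH⟩ := hgH e
  obtain ⟨θ, hθ⟩ := exists_isOddClause hyi.1 (pair a (pair e (g e)))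
  have hθC : θ ∈ C := ⟨a, (left_le_pair _ _).trans_lt hθ.lt, e,
    ((left_le_pair _ _).trans (right_le_pair _ _)).trans_lt hθ.lt, g e,
    ((right_le_pair _ _).trans (right_le_pair _ _)).trans_lt hθ.lt, ha, hyi, hθ⟩
  -- A single clause already contradicts homogeneity: all entries of `g e` lie in `H`, where `ν` is
  -- constant, and their number is even.
  obtain ⟨ν, -, hsat, hνc⟩ := hc {η | η = θ} (setOf_mem_sets (by infer_instance))
    ⟨θ + 1, fun i hi => by
      obtain rfl : i = θ := hi
      exact lt_add_one _⟩ (by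
      rintro η rfl
      exact hθC)
  exact hθ.not_satisfies hyi.1 (c = true)
    (fun i v hv => hνc v (hyH i hv.index_lt' v hv.lt hv)) (hsat θ rfl)

end L2Structure

/-- The given oracle `X` also witnesses that the model has a set. -/
theorem theorem4p4 (M : L2Structure.{u}) (hM : M.IsModelRCA0) :
    M.RSATAffine → M.DNR := fun hR X hX =>
  have : L2Structure.Model M := ⟨hM, X, hX⟩
  L2Structure.exists_dnr_of_rsatAffine hR hX
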